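/- Let $S\ge 1$, $\mathcal S=\{1,\dots,S\}$, let $\Delta\subset\mathbb R^{\mathcal S}$ be the probability simplex and $\|\cdot\|$ the $\ell^1$ norm on $\mathbb R^{\mathcal S}$. For $k\ne s$ in $\mathcal S$ let $Q_{ks}:\mathbb R^{\mathcal S}\to\mathbb R$ be locally Lipschitz, with $Q_{ks}\ge 0$ on $[0,\infty)^{\mathcal S}$; put $Q_{ss}=-\sum_{k\ne s}Q_{ks}$ and $Q(\phi)=(Q_{ks}(\phi))_{k,s\in\mathcal S}$. Fix $p\in(0,1]$. For each $N$ let $G^N$ be the Erdős–Rényi random graph on $\{1,\dots,N\}$ with edge probability $p$, that is, $a^N_{ij}=a^N_{ji}$, $a^N_{ii}=0$, and for $i<j$ the indicators $a^N_{ij}$ are i.i.d. with $\mathbb P(a^N_{ij}=1)=p=1-\mathbb P(a^N_{ij}=0)$. Put $\langle d\rangle=(N-1)p$. (i) Exact process. Each vertex carries a state in $\mathcal S$; let $\xi^N_i(t)=(\xi^N_{s,i}(t))_{s\in\mathcal S}$, where $\xi^N_{s,i}(t)$ is the indicator that vertex $i$ is in state $s$ at time $t$. Given $G^N$, the collection $(\xi^N_i(t))_{1\le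 i\le N}$, $t\ge0$, is a right-continuous continuous-time Markov chain in which one vertex changes its state at a time, vertex $i$ jumping from $s$ to $k\neq s$ at rate $Q_{ks}(\phi^N_i(t))$, where $\phi^N_i(t)=\frac1{\langle d\rangle}\sum_{j=1}^N a^N_{ij}\xi^N_j(t)$. The initial configuration is random and may depend on $G^N$. Put $x^N(t)=\frac1N\sum_{i=1}^N\xi^N_i(t)$. (ii) NIMFA. Let $z^N_1,\dots,z^N_N$ solve, for $t\ge 0$, $$\dot z^N_i(t)=Q(\rho^N_i(t))\,z^N_i(t),\qquad \rho^N_i(t)=\frac1{\langle d\rangle}\sum_{j=1}^N a^N_{ij}z^N_j(t),$$ with (possibly random) initial values $z^N_i(0)\in\Delta$. Put $y^N(t)=\frac1N\sum_{i=1}^N z^N_i(t)$. (iii) Mean-field limit. Let $u$ solve $\dot u(t)=Q(u(t))u(t)$ for $t\ge 0$, with deterministic $u(0)\in\Delta$. Then for every $T>0$, as $N\to\infty$: if $x^N(0)\to u(0)$ in probability, then $$\sup_{0\le t\le T}\|x^N(t)-u(t)\|\to0\quad\text{in probability};$$ and if $y^N(0)\to u(0)$ in probability, then $$\sup_{0\le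 t\le T}\|y^N(t)-u(t)\|\to0\quad\text{in probability}.$$ -/

import Mathlib

open MeasureTheory ProbabilityTheory Filter Topology
open scoped ENNReal Matrix

noncomputable section

namespace LocalDensity

/-- Configurations of the exact system: a local state in `Fin S` for each of the `N` vertices. -/
abbrev Config (N S : ℕ) : Type := Fin N → Fin S

/-- The transition rate matrix `Q(φ)` built from the rate functions: for `k ≠ s`, `q k s φ` is
the rate of the transition from `s` to `k`, so the source state is the column index. The diagonal
is fixed by `Q_{ss} = -∑_{k ≠ s} Q_{ks}`; the values `q s s` are never used. -/
def rateMatrix {S : ℕ} (q : Fin S → Fin S → (Fin S → ℝ) → ℝ) (φ : Fin S → ℝ) :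
    Matrix (Fin S) (Fin S) ℝ :=
  Matrix.of fun k s => if k = s then -∑ l ∈ Finset.univ.erase s, q l s φ else q k s φ

open Classical in
/-- The adjacency indicator `a_{ij}` of a simple graph. -/
def edgeIndicator {N : ℕ} (g : SimpleGraph (Fin N)) (i j : Fin N) : ℝ :=
  if g.Adj i j then 1 else 0

/-- The environment `(1 / ⟨d⟩) ∑_j a_{ij} v_j` seen by the vertex `i`, where `⟨d⟩ = (N - 1) p`.
It is `φ_i` for `v = ξ`, and `ρ_i` for `v = z`. -/
def environment {N S : ℕ} (p : ℝ) (g : SimpleGraph (Fin N)) (v : Fin N → Fin S → ℝ)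
    (i : Fin N) : Fin S → ℝ :=
  (1 / (((N : ℝ) - 1) * p)) • ∑ j, edgeIndicator g i j • v j

/-- The average `(1 / N) ∑_i v_i`. -/
def average {N S : ℕ} (v : Fin N → Fin S → ℝ) : Fin S → ℝ :=
  (1 / (N : ℝ)) • ∑ i, v i

/-- The indicator vectors `ξ_i` of a configuration. -/
def indicators {N S : ℕ} (c : Config N S) : Fin N → Fin S → ℝ :=
  fun i => Pi.single (c i) 1

/-- The rate at which the exact system on the graph `g` jumps from `c` to `c'`: one vertex `i`
changes its state from `c i` to some `k ≠ c i`, at rate `q k (c i) φ_i`. -/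
def jumpRate {N S : ℕ} (p : ℝ) (q : Fin S → Fin S → (Fin S → ℝ) → ℝ)
    (g : SimpleGraph (Fin N)) (c c' : Config N S) : ℝ :=
  ∑ i, ∑ k ∈ Finset.univ.erase (c i),
    if c' = Function.update c i k then q k (c i) (environment p g (indicators c) i) else 0

/-- The generator of the exact system on the graph `g`; here the source configuration is the row
index, and the rows sum to zero. -/
def generator {N S : ℕ} (p : ℝ) (q : Fin S → Fin S → (Fin S → ℝ) → ℝ)
    (g : SimpleGraph (Fin N)) : Matrix (Config N S) (Config N S) ℝ :=
  Matrix.of (jumpRate p q g) - Matrix.diagonal fun c => ∑ c', jumpRate p q g c c'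

/-- The σ-algebra generated by the random graph and the process up to time `s`. -/
abbrev past {Ω : Type*} {N S : ℕ} (G : Ω → SimpleGraph (Fin N)) (σ : ℝ → Ω → Config N S) (s : ℝ) :
    MeasurableSpace Ω :=
  MeasurableSpace.comap G inferInstance ⊔
    ⨆ r ∈ Set.Icc (0 : ℝ) s, MeasurableSpace.comap (σ r) inferInstance

/-- `σ` (at times `t ≥ 0`) is the local density-dependent Markov process in the random environment
`G`: given the graph, it is a continuous time Markov chain with right-continuous paths and with
generator `generator p q G`. Its initial configuration may depend on the graph. -/
structure IsExactSystem {Ω : Type*} [MeasurableSpace Ω] {N S : ℕ} (p : ℝ)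
    (q : Fin S → Fin S → (Fin S → ℝ) → ℝ) (P : Measure Ω) (G : Ω → SimpleGraph (Fin N))
    (σ : ℝ → Ω → Config N S) : Prop where
  measurable_graph : Measurable G
  measurable_process : ∀ t, 0 ≤ t → Measurable (σ t)
  right_continuous : ∀ᵐ ω ∂P, ∀ t, 0 ≤ t → ∀ᶠ r in 𝓝[>] t, σ r ω = σ t ω
  markov : ∀ s t, 0 ≤ s → 0 ≤ t → ∀ c : Config N S,
    P[fun ω => if σ (s + t) ω = c then (1 : ℝ) else 0 | past G σ s] =ᵐ[P]
      fun ω => NormedSpace.exp (t • generator p q (G ω)) (σ s ω) c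

/-- `u` solves the homogeneous mean-field equation `u' = Q(u) u` on `[0, ∞)`, from an initial
value in the simplex. -/
def IsMeanFieldSolution {S : ℕ} (q : Fin S → Fin S → (Fin S → ℝ) → ℝ) (u : ℝ → Fin S → ℝ) :
    Prop :=
  u 0 ∈ stdSimplex ℝ (Fin S) ∧
    ∀ t, 0 ≤ t → HasDerivWithinAt u (rateMatrix q (u t) *ᵥ u t) (Set.Ici 0) t

/-- `z` solves the NIMFA system `z_i' = Q(ρ_i) z_i`, `1 ≤ i ≤ N`, on `[0, ∞)` for the graph `g`,
from initial values in the simplex. -/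
def IsNIMFASolution {N S : ℕ} (p : ℝ) (q : Fin S → Fin S → (Fin S → ℝ) → ℝ)
    (g : SimpleGraph (Fin N)) (z : ℝ → Fin N → Fin S → ℝ) : Prop :=
  (∀ i, z 0 i ∈ stdSimplex ℝ (Fin S)) ∧
    ∀ t, 0 ≤ t → ∀ i, HasDerivWithinAt (fun r => z r i)
      (rateMatrix q (environment p g (z t) i) *ᵥ z t i) (Set.Ici 0) t

/-- The `ℓ¹` distance `‖v - w‖₁`, as an extended nonnegative real. -/
def dist₁ {S : ℕ} (v w : Fin S → ℝ) : ℝ≥0∞ :=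
  ENNReal.ofReal (∑ s, |v s - w s|)

/-- Convergence to `0` in probability of nonnegative random variables `X N`, which may live on
different probability spaces. -/
def TendstoZeroInProbability {Ω : ℕ → Type*} [∀ N, MeasurableSpace (Ω N)]
    (P : ∀ N, Measure (Ω N)) (X : ∀ N, Ω N → ℝ≥0∞) : Prop :=
  ∀ ε : ℝ≥0∞, 0 < ε → Tendsto (fun N => P N {ω | ε ≤ X N ω}) atTop (𝓝 0)

end LocalDensity

end

/-!
In an Erdős–Rényi graph the centered adjacency matrix `a - p` has `E ‖(a - p)ᵀ (a - p)‖² = O(N³)`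
in the Hilbert–Schmidt norm, because every rectangle with four distinct sides has mean zero. By
Cauchy–Schwarz, with high probability *every* bounded function on the vertices has nearly the
same mean over the neighborhoods as over the whole graph, up to a small error on average over the
vertices. As this is uniform in the function, it applies to the states at all times, however they
depend on the graph: the drift of the average is `Q(x) x` up to a uniformly small error.

For NIMFA, Grönwall's inequality concludes. For the exact process, the average observed along a
dyadic grid is the Euler scheme of the mean-field equation plus a martingale. Single jumps have size
`1 / N` and the total rate is `O(N)`, so the quadratic variation is `O(1 / N)` and Doob's maximal
inequality controls the martingale uniformly in the mesh. Right-continuity of the paths passes from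
the dyadic times to all times.
-/

namespace LocalDensity

/-! ### Local bounds on the rates -/

theorem locallyLipschitz_finsetSum {E F ι : Type*} [PseudoEMetricSpace E]
    [SeminormedAddCommGroup F] {f : ι → E → F} (s : Finset ι)
    (hf : ∀ i ∈ s, LocallyLipschitz (f i)) : LocallyLipschitz fun x => ∑ i ∈ s, f i x := by
  classical
  induction s using Finset.induction_on with
  | empty => simpa using LocallyLipschitz.const (0 : F)
  | insert i s hi ih =>
    simp only [Finset.sum_insert hi]
    exact (hf i (Finset.mem_insert_self i s)).add
      (ih fun j hj => hf j (Finset.mem_insert_of_mem hj))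

theorem locallyLipschitz_pi {E ι : Type*} [PseudoEMetricSpace E] [Fintype ι] {F : ι → Type*}
    [∀ i, PseudoEMetricSpace (F i)] {f : E → ∀ i, F i}
    (hf : ∀ i, LocallyLipschitz fun x => f x i) : LocallyLipschitz f := by
  intro x
  choose K t ht hK using fun i => hf i x
  refine ⟨∑ i, K i, ⋂ i, t i, Filter.iInter_mem.2 ht, fun y hy z hz => ?_⟩
  refine edist_pi_le_iff.2 fun i => (hK i (Set.mem_iInter.1 hy i) (Set.mem_iInter.1 hz i)).trans ?_
  gcongr
  exact Finset.single_le_sum (fun _ _ => zero_le) (Finset.mem_univ i)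

theorem exists_norm_le_and_norm_sub_le_of_locallyLipschitz {E F : Type*} [NormedAddCommGroup E]
    [ProperSpace E] [SeminormedAddCommGroup F] {f : E → F} (hf : LocallyLipschitz f) (R : ℝ) :
    ∃ C : ℝ, 0 ≤ C ∧ (∀ x, ‖x‖ ≤ R → ‖f x‖ ≤ C) ∧
      ∀ x y, ‖x‖ ≤ R → ‖y‖ ≤ R → ‖f x - f y‖ ≤ C * ‖x - y‖ := by
  have hball : IsCompact (Metric.closedBall (0 : E) R) := isCompact_closedBall 0 R
  obtain ⟨L, hL⟩ := hf.locallyLipschitzOn.exists_lipschitzOnWith_of_compact hball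
  obtain ⟨B, hB⟩ := hball.exists_bound_of_continuousOn hf.continuous.continuousOn
  refine ⟨max L B, le_max_of_le_left L.2, fun x hx => ?_, fun x y hx hy => ?_⟩
  · exact (hB x (mem_closedBall_zero_iff.2 hx)).trans (le_max_right _ _)
  · have h := hL.norm_sub_le (mem_closedBall_zero_iff.2 hx) (mem_closedBall_zero_iff.2 hy)
    exact h.trans (by gcongr; exact le_max_left _ _)

theorem norm_mulVec_le_of_abs_le {m n : Type*} [Fintype m] [Fintype n] {A : Matrix m n ℝ} {c : ℝ}
    (hc : 0 ≤ c) (hA : ∀ k s, |A k s| ≤ c) (v : n → ℝ) : ‖A *ᵥ v‖ ≤ Fintype.card n * c * ‖v‖ := by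
  refine (pi_norm_le_iff_of_nonneg (by positivity)).2 fun k => ?_
  calc ‖(A *ᵥ v) k‖ ≤ ∑ s, ‖A k s * v s‖ := norm_sum_le _ _
    _ ≤ ∑ _s : n, c * ‖v‖ := by
        refine Finset.sum_le_sum fun s _ => ?_
        rw [norm_mul]
        exact mul_le_mul (hA k s) (norm_le_pi_norm v s) (norm_nonneg _) hc
    _ = Fintype.card n * c * ‖v‖ := by simp [mul_assoc]

theorem rateMatrix_apply_of_ne {S : ℕ} (q : Fin S → Fin S → (Fin S → ℝ) → ℝ) (φ : Fin S → ℝ)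
    {k s : Fin S} (h : k ≠ s) : rateMatrix q φ k s = q k s φ := if_neg h

theorem rateMatrix_apply_self {S : ℕ} (q : Fin S → Fin S → (Fin S → ℝ) → ℝ) (φ : Fin S → ℝ)
    (s : Fin S) : rateMatrix q φ s s = -∑ k ∈ Finset.univ.erase s, q k s φ := if_pos rfl

/-- On the sup-norm ball of radius `R`, the matrices `Q(φ)` have operator norm at most `K` and
depend on `φ` in a Lipschitz way with constant `K`. -/
structure IsRateBound {S : ℕ} (q : Fin S → Fin S → (Fin S → ℝ) → ℝ) (R K : ℝ) : Prop where
  nonneg : 0 ≤ K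
  norm_mulVec_le : ∀ φ v, ‖φ‖ ≤ R → ‖rateMatrix q φ *ᵥ v‖ ≤ K * ‖v‖
  norm_mulVec_sub_le : ∀ φ ψ v, ‖φ‖ ≤ R → ‖ψ‖ ≤ R →
    ‖rateMatrix q φ *ᵥ v - rateMatrix q ψ *ᵥ v‖ ≤ K * ‖φ - ψ‖ * ‖v‖

section Rates

variable {S : ℕ} {q : Fin S → Fin S → (Fin S → ℝ) → ℝ}

theorem locallyLipschitz_rateMatrix_apply (hq_lip : ∀ k s, k ≠ s → LocallyLipschitz (q k s))
    (k s : Fin S) : LocallyLipschitz fun φ => rateMatrix q φ k s := by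
  obtain rfl | h := eq_or_ne k s
  · simp only [rateMatrix_apply_self]
    exact (locallyLipschitz_finsetSum _ fun l hl =>
      hq_lip l k (Finset.ne_of_mem_erase hl)).neg
  · simpa only [rateMatrix_apply_of_ne q _ h] using hq_lip k s h

theorem exists_isRateBound (hq_lip : ∀ k s, k ≠ s → LocallyLipschitz (q k s)) (R : ℝ) :
    ∃ K, IsRateBound q R K := by
  obtain ⟨C, hC, hbound, hlip⟩ := exists_norm_le_and_norm_sub_le_of_locallyLipschitz
    (f := fun φ k s => rateMatrix q φ k s)
    (locallyLipschitz_pi fun k => locallyLipschitz_pi fun s =>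
      locallyLipschitz_rateMatrix_apply hq_lip k s) R
  have hentry (A : Fin S → Fin S → ℝ) (k s : Fin S) : |A k s| ≤ ‖A‖ :=
    (norm_le_pi_norm (A k) s).trans (norm_le_pi_norm A k)
  refine ⟨S * C, by positivity, fun φ v hφ => ?_, fun φ ψ v hφ hψ => ?_⟩
  · simpa using norm_mulVec_le_of_abs_le hC (A := rateMatrix q φ)
      (fun k s => (hentry _ k s).trans (hbound φ hφ)) v
  · rw [← Matrix.sub_mulVec, mul_assoc (S : ℝ)]
    simpa using norm_mulVec_le_of_abs_le (by positivity) (A := rateMatrix q φ - rateMatrix q ψ)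
      (fun k s => (hentry _ k s).trans (hlip φ ψ hφ hψ)) v

namespace IsRateBound

variable {R K : ℝ}

theorem abs_rate_le (hK : IsRateBound q R K) {k s : Fin S} (h : k ≠ s) {φ : Fin S → ℝ}
    (hφ : ‖φ‖ ≤ R) : |q k s φ| ≤ K := by
  calc |q k s φ| = ‖(rateMatrix q φ *ᵥ Pi.single s 1) k‖ := by
        simp [rateMatrix_apply_of_ne q φ h]
    _ ≤ ‖rateMatrix q φ *ᵥ Pi.single s 1‖ := norm_le_pi_norm _ k
    _ ≤ K * ‖(Pi.single s 1 : Fin S → ℝ)‖ := hK.norm_mulVec_le φ _ hφ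
    _ = K := by simp [Pi.norm_single]

theorem norm_mulVec_sub_mulVec_le (hK : IsRateBound q R K) {φ ψ : Fin S → ℝ}
    (v w : Fin S → ℝ) (hφ : ‖φ‖ ≤ R) (hψ : ‖ψ‖ ≤ R) :
    ‖rateMatrix q φ *ᵥ v - rateMatrix q ψ *ᵥ w‖ ≤ K * ‖φ - ψ‖ * ‖v‖ + K * ‖v - w‖ := by
  calc ‖rateMatrix q φ *ᵥ v - rateMatrix q ψ *ᵥ w‖
      = ‖(rateMatrix q φ *ᵥ v - rateMatrix q ψ *ᵥ v) + rateMatrix q ψ *ᵥ (v - w)‖ := by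
        rw [Matrix.mulVec_sub, sub_add_sub_cancel]
    _ ≤ _ := (norm_add_le _ _).trans
        (add_le_add (hK.norm_mulVec_sub_le φ ψ v hφ hψ) (hK.norm_mulVec_le ψ _ hψ))

end IsRateBound

end Rates

/-! ### Invariance of the simplex -/

theorem abs_negPart_sq_sub_le (x y : ℝ) :
    |y⁻ ^ 2 - x⁻ ^ 2 + 2 * x⁻ * (y - x)| ≤ (y - x) ^ 2 := by
  rw [abs_le]
  rcases le_total 0 x with hx | hx <;> rcases le_total 0 y with hy | hy <;>
    simp only [negPart_of_nonneg, negPart_of_nonpos, hx, hy] <;> constructor <;> nlinarith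

theorem hasDerivAt_negPart_sq (x : ℝ) : HasDerivAt (fun y : ℝ => y⁻ ^ 2) (-(2 * x⁻)) x := by
  have hO : (fun y : ℝ => y⁻ ^ 2 - x⁻ ^ 2 - (y - x) • -(2 * x⁻)) =O[𝓝 x]
      fun y => ‖y - x‖ ^ 2 := by
    refine .of_bound 1 (.of_forall fun y => ?_)
    simp only [one_mul, norm_pow, Real.norm_eq_abs, sq_abs]
    convert abs_negPart_sq_sub_le x y using 2
    simp only [smul_eq_mul]
    ring
  exact hasDerivAt_iff_isLittleO.2
    (hO.trans_isLittleO (Asymptotics.isLittleO_pow_sub_sub x one_lt_two))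

theorem norm_sq_le_sum_sq {α : Type*} [Fintype α] (v : α → ℝ) : ‖v‖ ^ 2 ≤ ∑ i, v i ^ 2 := by
  refine (Real.le_sqrt (norm_nonneg v) (by positivity)).1 ?_
  refine (pi_norm_le_iff_of_nonneg (Real.sqrt_nonneg _)).2 fun i => Real.abs_le_sqrt ?_
  exact Finset.single_le_sum (f := fun i => v i ^ 2) (fun i _ => sq_nonneg _) (Finset.mem_univ i)

-- Grönwall's inequality for the sum of the squares of the negative parts.
theorem nonneg_of_neg_mul_norm_negPart_le_deriv {α : Type*} [Fintype α] {f f' : ℝ → α → ℝ}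
    {L t : ℝ} (hL : 0 ≤ L) (hf : ContinuousOn f (Set.Icc 0 t))
    (hf' : ∀ r ∈ Set.Ico 0 t, HasDerivWithinAt f (f' r) (Set.Ici r) r) (hf0 : 0 ≤ f 0)
    (hlower : ∀ r ∈ Set.Ico 0 t, ∀ i, f r i < 0 → -(L * ‖(f r)⁻‖) ≤ f' r i) :
    ∀ r ∈ Set.Icc 0 t, 0 ≤ f r := by
  set D : ℝ → ℝ := fun r => ∑ i, (f r i)⁻ ^ 2
  have hDcont : ContinuousOn D (Set.Icc 0 t) := continuousOn_finsetSum _ fun i _ =>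
    ((continuous_negPart.comp_continuousOn (continuousOn_pi.1 hf i)).pow 2)
  have hDderiv (r) (hr : r ∈ Set.Ico 0 t) :
      HasDerivWithinAt D (∑ i, -(2 * (f r i)⁻) * f' r i) (Set.Ici r) r :=
    HasDerivWithinAt.fun_sum fun i _ => HasDerivAt.comp_hasDerivWithinAt
      (h₂ := fun y : ℝ => y⁻ ^ 2) r (hasDerivAt_negPart_sq (f r i))
      (hasDerivWithinAt_pi.1 (hf' r hr) i)
  have hDbound (r) (hr : r ∈ Set.Ico 0 t) :
      ∑ i, -(2 * (f r i)⁻) * f' r i ≤ Fintype.card α * (2 * L) * D r + 0 := by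
    have hterm (i : α) : -(2 * (f r i)⁻) * f' r i ≤ 2 * L * ‖(f r)⁻‖ ^ 2 := by
      have hle : (f r i)⁻ ≤ ‖(f r)⁻‖ := (le_abs_self _).trans (norm_le_pi_norm (f r)⁻ i)
      rcases lt_or_ge (f r i) 0 with hi | hi
      · nlinarith [hlower r hr i hi, negPart_nonneg (f r i), mul_nonneg hL (norm_nonneg (f r)⁻)]
      · rw [negPart_of_nonneg hi]
        simp only [mul_zero, neg_zero, zero_mul]
        positivity
    calc ∑ i, -(2 * (f r i)⁻) * f' r i ≤ ∑ _i : α, 2 * L * D r := Finset.sum_le_sum fun i _ =>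
          (hterm i).trans (by gcongr; exact norm_sq_le_sum_sq (f r)⁻)
      _ = Fintype.card α * (2 * L) * D r + 0 := by simp [mul_assoc]
  have hD0 : D 0 ≤ 0 := (Finset.sum_eq_zero fun i _ => by simp [negPart_of_nonneg (hf0 i)]).le
  intro r hr i
  have hDr : D r ≤ 0 := by
    simpa [gronwallBound_ε0] using le_gronwallBound_of_liminf_deriv_right_le hDcont
      (fun r hr _ hlt => (hDderiv r hr).liminf_right_slope_le hlt) hD0 hDbound r hr
  have hi : (f r i)⁻ ^ 2 ≤ 0 := (Finset.single_le_sum (f := fun i => (f r i)⁻ ^ 2)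
    (fun i _ => sq_nonneg _) (Finset.mem_univ i)).trans hDr
  exact negPart_eq_zero.1 (pow_eq_zero_iff two_ne_zero |>.1 (le_antisymm hi (sq_nonneg _)))

theorem norm_sum_smul_le {ι E : Type*} [Fintype ι] [SeminormedAddCommGroup E] [NormedSpace ℝ E]
    {w : ι → ℝ} (hw : ∀ j, 0 ≤ w j) (v : ι → E) : ‖∑ j, w j • v j‖ ≤ (∑ j, w j) * ‖v‖ := by
  rw [Finset.sum_mul]
  refine norm_sum_le_of_le _ fun j _ => ?_
  rw [norm_smul, Real.norm_of_nonneg (hw j)]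
  exact mul_le_mul_of_nonneg_left (norm_le_pi_norm v j) (hw j)

instance hasSolidNorm_pi {ι : Type*} [Fintype ι] {E : ι → Type*} [∀ i, NormedAddCommGroup (E i)]
    [∀ i, Lattice (E i)] [∀ i, HasSolidNorm (E i)] : HasSolidNorm (∀ i, E i) where
  solid _ y h := (pi_norm_le_iff_of_nonneg (norm_nonneg y)).2 fun i =>
    (norm_le_norm_of_abs_le_abs (h i)).trans (norm_le_pi_norm y i)

theorem norm_posPart_le {E : Type*} [NormedAddCommGroup E] [Lattice E] [IsOrderedAddMonoid E]
    [HasSolidNorm E] (v : E) : ‖v⁺‖ ≤ ‖v‖ := by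
  refine norm_le_norm_of_abs_le_abs ?_
  rw [abs_of_nonneg (posPart_nonneg v), ← posPart_add_negPart]
  exact le_add_of_nonneg_right (negPart_nonneg v)

theorem norm_sub_posPart {E : Type*} [NormedAddCommGroup E] [Lattice E] [IsOrderedAddMonoid E]
    (v : E) : ‖v - v⁺‖ = ‖v⁻‖ := by
  rw [norm_sub_rev, ← sub_eq_of_eq_add' (sub_eq_iff_eq_add.1 (posPart_sub_negPart v))]

section Simplex

variable {S : ℕ} {q : Fin S → Fin S → (Fin S → ℝ) → ℝ}

theorem sum_rateMatrix_mulVec (q : Fin S → Fin S → (Fin S → ℝ) → ℝ) (φ v : Fin S → ℝ) :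
    ∑ k, (rateMatrix q φ *ᵥ v) k = 0 := by
  have hcol (s : Fin S) : ∑ k, rateMatrix q φ k s = 0 := by
    rw [← Finset.add_sum_erase _ _ (Finset.mem_univ s), rateMatrix_apply_self,
      Finset.sum_congr rfl fun k hk => rateMatrix_apply_of_ne q φ (Finset.ne_of_mem_erase hk),
      neg_add_cancel]
  simp only [Matrix.mulVec, dotProduct]
  rw [Finset.sum_comm]
  exact Finset.sum_eq_zero fun s _ => by rw [← Finset.sum_mul, hcol, zero_mul]

theorem rateMatrix_mulVec_apply_nonneg
    (hq_nonneg : ∀ k s, k ≠ s → ∀ φ : Fin S → ℝ, (∀ l, 0 ≤ φ l) → 0 ≤ q k s φ)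
    {φ v : Fin S → ℝ} (hφ : 0 ≤ φ) (hv : 0 ≤ v) {s : Fin S} (hs : v s = 0) :
    0 ≤ (rateMatrix q φ *ᵥ v) s := by
  rw [Matrix.mulVec, dotProduct]
  refine Finset.sum_nonneg fun k _ => ?_
  obtain rfl | h := eq_or_ne s k
  · simp [hs]
  · rw [rateMatrix_apply_of_ne q φ h]
    exact mul_nonneg (hq_nonneg s k h φ hφ) (hv k)

theorem IsRateBound.neg_le_mulVec_apply {R K : ℝ} (hK : IsRateBound q R K)
    (hq_nonneg : ∀ k s, k ≠ s → ∀ φ : Fin S → ℝ, (∀ l, 0 ≤ φ l) → 0 ≤ q k s φ)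
    {φ ψ v : Fin S → ℝ} (hφ : ‖φ‖ ≤ R) (hψ : ‖ψ‖ ≤ R) (hψ0 : 0 ≤ ψ) {s : Fin S} (hs : v s ≤ 0) :
    -(K * ‖φ - ψ‖ * ‖v‖ + K * ‖v⁻‖) ≤ (rateMatrix q φ *ᵥ v) s := by
  have hpos : 0 ≤ (rateMatrix q ψ *ᵥ v⁺) s :=
    rateMatrix_mulVec_apply_nonneg hq_nonneg hψ0 (posPart_nonneg v)
      (posPart_eq_zero.2 hs : (v s)⁺ = 0)
  have hdiff := (norm_le_pi_norm _ s).trans (hK.norm_mulVec_sub_mulVec_le v v⁺ hφ hψ)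
  rw [norm_sub_posPart, Pi.sub_apply, Real.norm_eq_abs] at hdiff
  linarith [neg_le_of_abs_le hdiff]

theorem IsRateBound.neg_le_interaction_apply {ι : Type*} [Fintype ι] {B W K : ℝ}
    (hK : IsRateBound q (W * B) K)
    (hq_nonneg : ∀ k s, k ≠ s → ∀ φ : Fin S → ℝ, (∀ l, 0 ≤ φ l) → 0 ≤ q k s φ)
    {w : ι → ℝ} (hw : ∀ j, 0 ≤ w j) (hW : ∑ j, w j ≤ W) {v : ι → Fin S → ℝ} (hv : ‖v‖ ≤ B)
    {i : ι} {s : Fin S} (hs : v i s ≤ 0) :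
    -(K * (W * B + 1) * ‖v⁻‖) ≤ (rateMatrix q (∑ j, w j • v j) *ᵥ v i) s := by
  have hK0 := hK.nonneg
  have hW0 : 0 ≤ W := (Finset.sum_nonneg fun j _ => hw j).trans hW
  have hsum (u : ι → Fin S → ℝ) : ‖∑ j, w j • u j‖ ≤ W * ‖u‖ :=
    (norm_sum_smul_le hw u).trans (by gcongr)
  have hdiff : ‖∑ j, w j • v j - ∑ j, w j • v⁺ j‖ ≤ W * ‖v⁻‖ := by
    rw [← Finset.sum_sub_distrib, ← norm_sub_posPart v]
    simpa only [smul_sub, Pi.sub_apply] using hsum (v - v⁺)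
  have hlower := hK.neg_le_mulVec_apply hq_nonneg (ψ := ∑ j, w j • v⁺ j)
    ((hsum v).trans (by gcongr)) ((hsum v⁺).trans (by gcongr; exact (norm_posPart_le v).trans hv))
    (Finset.sum_nonneg fun j _ => smul_nonneg (hw j) (posPart_nonneg (v j))) hs
  refine le_trans (neg_le_neg ?_) hlower
  calc _ ≤ K * (W * ‖v⁻‖) * B + K * ‖v⁻‖ := by
        gcongr
        · exact (norm_le_pi_norm v i).trans hv
        · exact norm_le_pi_norm v⁻ i
    _ = K * (W * B + 1) * ‖v⁻‖ := by ring

theorem nonneg_of_interacting_system {ι : Type*} [Fintype ι] {w : ι → ι → ℝ}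
    {z : ℝ → ι → Fin S → ℝ} (hq_lip : ∀ k s, k ≠ s → LocallyLipschitz (q k s))
    (hq_nonneg : ∀ k s, k ≠ s → ∀ φ : Fin S → ℝ, (∀ l, 0 ≤ φ l) → 0 ≤ q k s φ)
    (hw : ∀ i j, 0 ≤ w i j) (hz0 : ∀ i, 0 ≤ z 0 i)
    (hz : ∀ t, 0 ≤ t → ∀ i, HasDerivWithinAt (fun r => z r i)
      (rateMatrix q (∑ j, w i j • z t j) *ᵥ z t i) (Set.Ici 0) t)
    {t : ℝ} (ht : 0 ≤ t) (i : ι) : 0 ≤ z t i := by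
  have hzcont : ContinuousOn z (Set.Icc 0 t) := continuousOn_pi.2 fun i r hr =>
    (hz r hr.1 i).continuousWithinAt.mono Set.Icc_subset_Ici_self
  obtain ⟨B, hB⟩ := isCompact_Icc.exists_bound_of_continuousOn hzcont
  have hB0 : 0 ≤ B := (norm_nonneg _).trans (hB 0 ⟨le_rfl, ht⟩)
  set W : ℝ := ∑ i, ∑ j, w i j
  have hrow (i : ι) : 0 ≤ ∑ j, w i j := Finset.sum_nonneg fun j _ => hw i j
  have hW (i : ι) : ∑ j, w i j ≤ W :=
    Finset.single_le_sum (f := fun i => ∑ j, w i j) (fun i _ => hrow i) (Finset.mem_univ i)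
  have hW0 : 0 ≤ W := Finset.sum_nonneg fun i _ => hrow i
  obtain ⟨K, hK⟩ := exists_isRateBound hq_lip (W * B)
  have hK0 := hK.nonneg
  have hcurry (v : ι → Fin S → ℝ) : ‖v⁻‖ ≤ ‖(Function.uncurry v)⁻‖ :=
    (pi_norm_le_iff_of_nonneg (norm_nonneg _)).2 fun i =>
      (pi_norm_le_iff_of_nonneg (norm_nonneg _)).2 fun s =>
        norm_le_pi_norm (Function.uncurry v)⁻ (i, s)
  have hnonneg := nonneg_of_neg_mul_norm_negPart_le_deriv (L := K * (W * B + 1)) (by positivity)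
    (f := fun r => Function.uncurry (z r))
    (continuousOn_pi.2 fun x => continuousOn_pi.1 (continuousOn_pi.1 hzcont x.1) x.2)
    (fun r hr => hasDerivWithinAt_pi.2 fun x => (hasDerivWithinAt_pi.1 (hz r hr.1 x.1) x.2).mono
      (Set.Ici_subset_Ici.2 hr.1)) (fun x => hz0 x.1 x.2)
    (fun r hr x hx => le_trans (neg_le_neg (by gcongr; exact hcurry _))
      (hK.neg_le_interaction_apply hq_nonneg (hw x.1) (hW x.1) (hB r ⟨hr.1, hr.2.le⟩) hx.le))
    t ⟨ht, le_rfl⟩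
  exact fun s => hnonneg (i, s)

theorem sum_eq_of_hasDerivWithinAt_rateMatrix {φ z : ℝ → Fin S → ℝ}
    (hz : ∀ t, 0 ≤ t → HasDerivWithinAt z (rateMatrix q (φ t) *ᵥ z t) (Set.Ici 0) t)
    {t : ℝ} (ht : 0 ≤ t) : ∑ s, z t s = ∑ s, z 0 s := by
  have hderiv (r) (hr : 0 ≤ r) :
      HasDerivWithinAt (fun r => ∑ s, z r s) 0 (Set.Ici 0) r := by
    have h := HasDerivWithinAt.fun_sum (u := Finset.univ) fun s _ =>
      hasDerivWithinAt_pi.1 (hz r hr) s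
    rwa [sum_rateMatrix_mulVec] at h
  exact constant_of_has_deriv_right_zero
    (fun r hr => (hderiv r hr.1).continuousWithinAt.mono Set.Icc_subset_Ici_self)
    (fun r hr => (hderiv r hr.1).mono (Set.Ici_subset_Ici.2 hr.1)) t ⟨ht, le_rfl⟩

theorem mem_stdSimplex_of_interacting_system {ι : Type*} [Fintype ι] {w : ι → ι → ℝ}
    {z : ℝ → ι → Fin S → ℝ} (hq_lip : ∀ k s, k ≠ s → LocallyLipschitz (q k s))
    (hq_nonneg : ∀ k s, k ≠ s → ∀ φ : Fin S → ℝ, (∀ l, 0 ≤ φ l) → 0 ≤ q k s φ)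
    (hw : ∀ i j, 0 ≤ w i j) (hz0 : ∀ i, z 0 i ∈ stdSimplex ℝ (Fin S))
    (hz : ∀ t, 0 ≤ t → ∀ i, HasDerivWithinAt (fun r => z r i)
      (rateMatrix q (∑ j, w i j • z t j) *ᵥ z t i) (Set.Ici 0) t)
    {t : ℝ} (ht : 0 ≤ t) (i : ι) : z t i ∈ stdSimplex ℝ (Fin S) :=
  ⟨nonneg_of_interacting_system hq_lip hq_nonneg hw (fun j => (hz0 j).1) hz ht i,
    (sum_eq_of_hasDerivWithinAt_rateMatrix (fun r hr => hz r hr i) ht).trans (hz0 i).2⟩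

end Simplex

/-! ### Uniform density of the binomial random graph -/

instance measurableSingletonClass_simpleGraph {V : Type*} [Countable V] :
    MeasurableSingletonClass (SimpleGraph V) where
  measurableSet_singleton g := by
    have hadj : ({g} : Set (SimpleGraph V)) = SimpleGraph.Adj ⁻¹' {g.Adj} :=
      Set.ext fun h => SimpleGraph.ext_iff
    rw [hadj]
    exact SimpleGraph.measurable_adj (measurableSet_singleton _)

open Classical in
/-- The centered adjacency matrix `a_{ij} - p` of a graph, with vanishing diagonal. -/
noncomputable def centeredAdj {V : Type*} (p : ℝ) (g : SimpleGraph V) : Matrix V V ℝ :=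
  Matrix.of fun i j => if i = j then 0 else (if g.Adj i j then 1 else 0) - p

/-- The squared Frobenius norm of the Gram matrix `AᵀA`. For a centered adjacency matrix its
expectation is of lower order than the trivial bound, which quantifies the lack of structure of the
graph. -/
noncomputable def gramEnergy {m n : Type*} [Fintype m] [Fintype n] (A : Matrix m n ℝ) : ℝ :=
  ∑ j, ∑ k, (Aᵀ * A) j k ^ 2

theorem gramEnergy_nonneg {m n : Type*} [Fintype m] [Fintype n] (A : Matrix m n ℝ) :
    0 ≤ gramEnergy A :=
  Finset.sum_nonneg fun _ _ => Finset.sum_nonneg fun _ _ => sq_nonneg _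

theorem sum_sq_mulVec_le {m n : Type*} [Fintype m] [Fintype n] (A : Matrix m n ℝ) {v : n → ℝ}
    (hv : ∀ j, |v j| ≤ 1) : ∑ i, (A *ᵥ v) i ^ 2 ≤ ∑ j, ∑ k, |(Aᵀ * A) j k| := by
  calc ∑ i, (A *ᵥ v) i ^ 2 = (A *ᵥ v) ⬝ᵥ (A *ᵥ v) := by simp only [dotProduct, sq]
    _ = v ⬝ᵥ ((Aᵀ * A) *ᵥ v) := by
        rw [← Matrix.mulVec_mulVec, Matrix.dotProduct_mulVec v, Matrix.vecMul_transpose]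
    _ = ∑ j, ∑ k, v j * ((Aᵀ * A) j k * v k) := by
        simp only [Matrix.mulVec, dotProduct, Finset.mul_sum]
    _ ≤ ∑ j, ∑ k, |(Aᵀ * A) j k| := by
        refine Finset.sum_le_sum fun j _ => Finset.sum_le_sum fun k _ => (le_abs_self _).trans ?_
        rw [mul_left_comm, abs_mul, abs_mul]
        exact mul_le_of_le_one_right (abs_nonneg _) (mul_le_one₀ (hv j) (abs_nonneg _) (hv k))

-- The Cauchy–Schwarz inequality, twice.
theorem sum_abs_mulVec_pow_four_le {m n : Type*} [Fintype m] [Fintype n] (A : Matrix m n ℝ)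
    {v : n → ℝ} (hv : ∀ j, |v j| ≤ 1) :
    (∑ i, |(A *ᵥ v) i|) ^ 4 ≤ (Fintype.card m : ℝ) ^ 2 * Fintype.card n ^ 2 * gramEnergy A := by
  have hgram : (∑ j, ∑ k, |(Aᵀ * A) j k|) ^ 2 ≤ (Fintype.card n : ℝ) ^ 2 * gramEnergy A := by
    rw [← Finset.sum_product', gramEnergy, ← Finset.sum_product' (f := fun j k => (Aᵀ * A) j k ^ 2)]
    simpa [sq] using sq_sum_le_card_mul_sum_sq (s := (Finset.univ : Finset n) ×ˢ Finset.univ)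
      (f := fun x => |(Aᵀ * A) x.1 x.2|)
  calc (∑ i, |(A *ᵥ v) i|) ^ 4 = ((∑ i, |(A *ᵥ v) i|) ^ 2) ^ 2 := by ring
    _ ≤ (Fintype.card m * ∑ i, (A *ᵥ v) i ^ 2) ^ 2 := by
        gcongr
        simpa using sq_sum_le_card_mul_sum_sq (s := Finset.univ) (f := fun i => |(A *ᵥ v) i|)
    _ ≤ (Fintype.card m * ∑ j, ∑ k, |(Aᵀ * A) j k|) ^ 2 := by
        gcongr
        exact sum_sq_mulVec_le A hv
    _ = (Fintype.card m : ℝ) ^ 2 * (∑ j, ∑ k, |(Aᵀ * A) j k|) ^ 2 := mul_pow _ _ _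
    _ ≤ (Fintype.card m : ℝ) ^ 2 * (Fintype.card n ^ 2 * gramEnergy A) := by gcongr
    _ = (Fintype.card m : ℝ) ^ 2 * Fintype.card n ^ 2 * gramEnergy A := (mul_assoc _ _ _).symm

section BinomialRandom

variable {V : Type*}

/-- The law of the indicator that the pair `e` belongs to the random edge set; a diagonal pair
never does. -/
noncomputable abbrev edgeLaw (p : unitInterval) (e : Sym2 V) : Measure Prop :=
  unitInterval.toNNReal p • Measure.dirac (e ∈ (Sym2.diagSetᶜ : Set (Sym2 V))) +
    unitInterval.toNNReal (unitInterval.symm p) • Measure.dirac False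

open Classical in
/-- The centered indicator of an edge, as a function of the family of all edge indicators. -/
noncomputable def centeredEdge (p : ℝ) (e : Sym2 V) (ω : Sym2 V → Prop) : ℝ :=
  (if ω e then 1 else 0) - p

theorem measurable_centeredEdge (p : ℝ) (e : Sym2 V) : Measurable (centeredEdge p e) := by
  classical
  exact (Measurable.of_discrete (f := fun b : Prop => (if b then (1 : ℝ) else 0) - p)).comp
    (measurable_pi_apply e)

theorem iIndepFun_centeredEdge (p : unitInterval) :
    iIndepFun (centeredEdge (V := V) p) (Measure.infinitePi (edgeLaw p)) := by
  classical
  exact iIndepFun_infinitePi (P := edgeLaw p)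
    (X := fun _ b => (if b then (1 : ℝ) else 0) - (p : ℝ)) fun _ => Measurable.of_discrete

theorem integral_centeredEdge (p : unitInterval) {e : Sym2 V} (he : ¬ e.IsDiag) :
    ∫ ω, centeredEdge p e ω ∂(Measure.infinitePi (edgeLaw p)) = 0 := by
  classical
  have heval : ∫ ω, centeredEdge p e ω ∂(Measure.infinitePi (edgeLaw p)) =
      ∫ b, ((if b then (1 : ℝ) else 0) - (p : ℝ)) ∂(edgeLaw p e) := by
    rw [← Measure.infinitePi_map_eval (edgeLaw p) e, integral_map
      (measurable_pi_apply e).aemeasurable Measurable.of_discrete.aestronglyMeasurable]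
    rfl
  have he' : e ∈ (Sym2.diagSetᶜ : Set (Sym2 V)) := by simpa using he
  rw [heval, integral_add_measure .of_finite .of_finite, integral_smul_nnreal_measure,
    integral_smul_nnreal_measure, integral_dirac, integral_dirac, if_pos he', if_neg id]
  simp only [NNReal.smul_def, unitInterval.coe_toNNReal, unitInterval.coe_symm_eq, smul_eq_mul]
  ring

theorem integral_prod_centeredEdge_mul_eq_zero (p : unitInterval) {e : Sym2 V} (he : ¬ e.IsDiag)
    {T : Finset (Sym2 V)} (heT : e ∉ T) :
    ∫ ω, (∏ e' ∈ T, centeredEdge p e' ω) * centeredEdge p e ω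
      ∂(Measure.infinitePi (edgeLaw p)) = 0 := by
  have hmeas := measurable_centeredEdge (V := V) p
  have hprod : Measurable (∏ e' ∈ T, centeredEdge (p : ℝ) e') := by
    rw [Finset.prod_fn]
    exact Finset.measurable_prod T fun e' _ => hmeas e'
  have hindep := (iIndepFun_centeredEdge p).indepFun_finsetProd_of_notMem hmeas heT
  calc _ = ∫ ω, ((∏ e' ∈ T, centeredEdge (p : ℝ) e') * centeredEdge p e) ω
          ∂(Measure.infinitePi (edgeLaw p)) := by simp only [Pi.mul_apply, Finset.prod_apply]
    _ = 0 := by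
        rw [hindep.integral_mul_eq_mul_integral hprod.aestronglyMeasurable
          (hmeas e).aestronglyMeasurable, integral_centeredEdge p he, mul_zero]

theorem centeredAdj_fromEdgeSet (p : ℝ) {i j : V} (hij : i ≠ j) (ω : Sym2 V → Prop) :
    centeredAdj p (SimpleGraph.fromEdgeSet {e | ω e}) i j = centeredEdge p s(i, j) ω := by
  have hadj : (SimpleGraph.fromEdgeSet {e | ω e}).Adj i j ↔ ω s(i, j) := by
    rw [SimpleGraph.fromEdgeSet_adj]
    exact and_iff_left hij
  simp only [centeredAdj, centeredEdge, Matrix.of_apply, if_neg hij]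
  by_cases h : ω s(i, j)
  · rw [if_pos h, if_pos (hadj.2 h)]
  · rw [if_neg h, if_neg (mt hadj.1 h)]

theorem abs_centeredAdj_le_one (p : unitInterval) (g : SimpleGraph V) (i j : V) :
    |centeredAdj p g i j| ≤ 1 := by
  have hp := p.2
  simp only [centeredAdj, Matrix.of_apply, abs_le]
  split_ifs <;> constructor <;> linarith [hp.1, hp.2]

theorem abs_centeredAdj_mul_le_one (p : unitInterval) (g : SimpleGraph V) (i j k : V) :
    |centeredAdj p g i j * centeredAdj p g i k| ≤ 1 := by
  rw [abs_mul]
  exact mul_le_one₀ (abs_centeredAdj_le_one p g i j) (abs_nonneg _) (abs_centeredAdj_le_one p g i k)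

theorem integral_binomialRandom [Finite V] (p : unitInterval) (f : SimpleGraph V → ℝ) :
    ∫ g, f g ∂SimpleGraph.binomialRandom V p =
      ∫ ω, f (SimpleGraph.fromEdgeSet {e | ω e}) ∂(Measure.infinitePi (edgeLaw p)) := by
  have hset : Measurable fun ω : Sym2 V → Prop => {e | ω e} :=
    measurable_set_iff.2 fun e => measurable_pi_apply e
  rw [SimpleGraph.binomialRandom_eq_map, setBernoulli_eq_map,
    Measure.map_map SimpleGraph.measurable_fromEdgeSet hset,
    integral_map (SimpleGraph.measurable_fromEdgeSet.comp hset).aemeasurable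
      Measurable.of_discrete.aestronglyMeasurable]
  rfl

-- The four edges of a rectangle are distinct, so one independent centered factor splits off.
theorem integral_centeredAdj_rectangle [Finite V] (p : unitInterval) {i i' j k : V}
    (hi : i ≠ i') (hj : j ≠ k) :
    ∫ g, (centeredAdj p g i j * centeredAdj p g i k) *
      (centeredAdj p g i' j * centeredAdj p g i' k) ∂SimpleGraph.binomialRandom V p = 0 := by
  classical
  by_cases h : i = j ∨ i = k ∨ i' = j ∨ i' = k
  · have hzero (g : SimpleGraph V) : (centeredAdj p g i j * centeredAdj p g i k) *
        (centeredAdj p g i' j * centeredAdj p g i' k) = 0 := by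
      rcases h with h | h | h | h <;> simp [centeredAdj, h]
    simp [hzero]
  push Not at h
  obtain ⟨hij, hik, hi'j, hi'k⟩ := h
  have hmem : s(i, j) ∉ ({s(i, k), s(i', j), s(i', k)} : Finset (Sym2 V)) := by
    simp only [Finset.mem_insert, Finset.mem_singleton, Sym2.eq_iff]
    grind
  rw [integral_binomialRandom,
    ← integral_prod_centeredEdge_mul_eq_zero p (e := s(i, j)) (by simpa using hij) hmem]
  refine integral_congr_ae (.of_forall fun ω => ?_)
  dsimp only
  rw [centeredAdj_fromEdgeSet _ hij, centeredAdj_fromEdgeSet _ hik, centeredAdj_fromEdgeSet _ hi'j,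
    centeredAdj_fromEdgeSet _ hi'k, Finset.prod_insert, Finset.prod_insert, Finset.prod_singleton]
  · ring
  · simp only [Finset.mem_singleton, Sym2.eq_iff]
    grind
  · simp only [Finset.mem_insert, Finset.mem_singleton, Sym2.eq_iff]
    grind

variable [Fintype V]

theorem integral_sq_gram_le_of_ne (p : unitInterval) {j k : V} (hjk : j ≠ k) :
    ∫ g, ((centeredAdj p g)ᵀ * centeredAdj p g) j k ^ 2 ∂SimpleGraph.binomialRandom V p ≤
      Fintype.card V := by
  simp only [Matrix.mul_apply, Matrix.transpose_apply, sq, Finset.sum_mul_sum]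
  rw [integral_finsetSum _ fun _ _ => .of_finite]
  calc _ ≤ ∑ _i : V, (1 : ℝ) := Finset.sum_le_sum fun i _ => ?_
    _ = Fintype.card V := by simp
  rw [integral_finsetSum _ fun _ _ => .of_finite, Finset.sum_eq_single i
    (fun i' _ hi' => integral_centeredAdj_rectangle p hi'.symm hjk) (by simp)]
  calc _ ≤ ∫ _, (1 : ℝ) ∂SimpleGraph.binomialRandom V p :=
        integral_mono .of_finite .of_finite fun g => (le_abs_self _).trans <| by
          rw [abs_mul]
          exact mul_le_one₀ (abs_centeredAdj_mul_le_one p g i j k) (abs_nonneg _)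
            (abs_centeredAdj_mul_le_one p g i j k)
    _ = 1 := by simp

theorem integral_sq_gram_le (p : unitInterval) (j k : V) :
    ∫ g, ((centeredAdj p g)ᵀ * centeredAdj p g) j k ^ 2 ∂SimpleGraph.binomialRandom V p ≤
      (Fintype.card V : ℝ) ^ 2 := by
  have hentry (g : SimpleGraph V) : |((centeredAdj p g)ᵀ * centeredAdj p g) j k| ≤
      Fintype.card V := by
    rw [Matrix.mul_apply]
    exact (Finset.abs_sum_le_sum_abs _ _).trans <|
      (Finset.sum_le_sum fun i _ => abs_centeredAdj_mul_le_one p g i j k).trans (by simp)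
  calc _ ≤ ∫ _, (Fintype.card V : ℝ) ^ 2 ∂SimpleGraph.binomialRandom V p :=
        integral_mono .of_finite .of_finite fun g =>
          sq_le_sq.2 ((hentry g).trans (le_abs_self _))
    _ = (Fintype.card V : ℝ) ^ 2 := by simp

theorem integral_gramEnergy_centeredAdj_le (p : unitInterval) :
    ∫ g, gramEnergy (centeredAdj p g) ∂SimpleGraph.binomialRandom V p ≤
      2 * (Fintype.card V : ℝ) ^ 3 := by
  classical
  have hrow (j : V) : ∑ k, ∫ g, ((centeredAdj p g)ᵀ * centeredAdj p g) j k ^ 2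
      ∂SimpleGraph.binomialRandom V p ≤ 2 * (Fintype.card V : ℝ) ^ 2 := by
    rw [← Finset.add_sum_erase _ _ (Finset.mem_univ j), two_mul]
    refine add_le_add (integral_sq_gram_le p j j) ?_
    calc _ ≤ ∑ _k ∈ Finset.univ.erase j, (Fintype.card V : ℝ) := Finset.sum_le_sum fun k hk =>
          integral_sq_gram_le_of_ne p (Finset.ne_of_mem_erase hk).symm
      _ ≤ ∑ _k : V, (Fintype.card V : ℝ) :=
          Finset.sum_le_sum_of_subset_of_nonneg (Finset.subset_univ _) fun _ _ _ => by positivity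
      _ = (Fintype.card V : ℝ) ^ 2 := by simp [sq]
  simp only [gramEnergy]
  rw [integral_finsetSum _ fun _ _ => .of_finite]
  simp_rw [integral_finsetSum _ fun _ _ => Integrable.of_finite]
  calc _ ≤ ∑ _j : V, 2 * (Fintype.card V : ℝ) ^ 2 := Finset.sum_le_sum fun j _ => hrow j
    _ = 2 * (Fintype.card V : ℝ) ^ 3 := by
        simp only [Finset.sum_const, Finset.card_univ, nsmul_eq_mul]
        ring

end BinomialRandom

/-- All functions bounded by one have, for most vertices, the same mean over the neighborhood of
the vertex (normalized by the mean degree) as over all vertices, up to an error `η` on average. -/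
def IsBalanced {N : ℕ} (p : ℝ) (g : SimpleGraph (Fin N)) (η : ℝ) : Prop :=
  ∀ v : Fin N → ℝ, (∀ i, |v i| ≤ 1) →
    ∑ i, |1 / (((N : ℝ) - 1) * p) * ∑ j, edgeIndicator g i j * v j - 1 / (N : ℝ) * ∑ j, v j| ≤
      η * N

section Balanced

variable {N : ℕ} {p η : ℝ}

theorem sum_edgeIndicator_mul (p : ℝ) (g : SimpleGraph (Fin N)) (v : Fin N → ℝ) (i : Fin N) :
    ∑ j, edgeIndicator g i j * v j = (centeredAdj p g *ᵥ v) i + p * (∑ j, v j - v i) := by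
  have hterm (j : Fin N) : edgeIndicator g i j * v j =
      centeredAdj p g i j * v j + p * v j - (if i = j then p * v j else 0) := by
    obtain rfl | hij := eq_or_ne i j
    · simp [centeredAdj, edgeIndicator]
    · simp only [centeredAdj, edgeIndicator, Matrix.of_apply, if_neg hij]
      ring
  simp only [hterm, Finset.sum_sub_distrib, Finset.sum_add_distrib, ← Finset.mul_sum,
    Finset.sum_ite_eq, Finset.mem_univ, if_true, Matrix.mulVec, dotProduct]
  ring

theorem abs_neighborhood_mean_sub_mean_le (hN : 2 ≤ N) (hp : 0 < p) (g : SimpleGraph (Fin N))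
    {v : Fin N → ℝ} (hv : ∀ i, |v i| ≤ 1) (i : Fin N) :
    |1 / (((N : ℝ) - 1) * p) * ∑ j, edgeIndicator g i j * v j - 1 / (N : ℝ) * ∑ j, v j| ≤
      1 / ((N : ℝ) - 1) * (|(centeredAdj p g *ᵥ v) i| / p + 2) := by
  have hN' : (2 : ℝ) ≤ N := by exact_mod_cast hN
  have hN1 : (0 : ℝ) < (N : ℝ) - 1 := by linarith
  have hmean : |(∑ j, v j) / (N : ℝ)| ≤ 1 := by
    rw [abs_div, Nat.abs_cast]
    exact div_le_one_of_le₀ ((Finset.abs_sum_le_sum_abs _ _).trans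
      ((Finset.sum_le_sum fun i _ => hv i).trans (by simp))) (by positivity)
  calc _ = |1 / ((N : ℝ) - 1) * ((centeredAdj p g *ᵥ v) i / p + ((∑ j, v j) / N - v i))| := by
        rw [sum_edgeIndicator_mul p]
        congr 1
        field_simp
        ring
    _ = 1 / ((N : ℝ) - 1) * |(centeredAdj p g *ᵥ v) i / p + ((∑ j, v j) / N - v i)| := by
        rw [abs_mul, abs_of_pos (by positivity)]
    _ ≤ 1 / ((N : ℝ) - 1) * (|(centeredAdj p g *ᵥ v) i| / p + 2) := by
        refine mul_le_mul_of_nonneg_left ?_ (by positivity)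
        refine (abs_add_le _ _).trans ?_
        rw [abs_div, abs_of_pos hp]
        linarith [abs_sub ((∑ j, v j) / (N : ℝ)) (v i), hv i]

theorem isBalanced_of_gramEnergy_le (hN : 2 ≤ N) (hp : 0 < p) (g : SimpleGraph (Fin N))
    (hη : 0 ≤ η) (h : gramEnergy (centeredAdj p g) ≤ η ^ 4 * (N : ℝ) ^ 4) :
    IsBalanced p g (2 * η / p + 4 / N) := by
  intro v hv
  have hN' : (2 : ℝ) ≤ N := by exact_mod_cast hN
  have hN1 : (0 : ℝ) < (N : ℝ) - 1 := by linarith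
  have hinv : 1 / ((N : ℝ) - 1) ≤ 2 / N := by
    rw [div_le_div_iff₀ hN1 (by linarith)]
    linarith
  have hcentered : ∑ i, |(centeredAdj p g *ᵥ v) i| ≤ η * (N : ℝ) ^ 2 := by
    refine le_of_pow_le_pow_left₀ four_ne_zero (by positivity) ?_
    calc _ ≤ (N : ℝ) ^ 2 * N ^ 2 * gramEnergy (centeredAdj p g) := by
          simpa using sum_abs_mulVec_pow_four_le (centeredAdj p g) hv
      _ ≤ (N : ℝ) ^ 2 * N ^ 2 * (η ^ 4 * (N : ℝ) ^ 4) := by gcongr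
      _ = (η * (N : ℝ) ^ 2) ^ 4 := by ring
  calc _ ≤ ∑ i, 1 / ((N : ℝ) - 1) * (|(centeredAdj p g *ᵥ v) i| / p + 2) :=
        Finset.sum_le_sum fun i _ => abs_neighborhood_mean_sub_mean_le hN hp g hv i
    _ = 1 / ((N : ℝ) - 1) * ((∑ i, |(centeredAdj p g *ᵥ v) i|) / p + N * 2) := by
        rw [← Finset.mul_sum, Finset.sum_add_distrib, Finset.sum_div]
        simp
    _ ≤ 2 / N * (η * (N : ℝ) ^ 2 / p + N * 2) := by gcongr
    _ = (2 * η / p + 4 / N) * N := by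
        field_simp
        ring

theorem IsBalanced.mono {g : SimpleGraph (Fin N)} {η' : ℝ} (hg : IsBalanced p g η) (h : η ≤ η') :
    IsBalanced p g η' := fun v hv => (hg v hv).trans (by gcongr)

theorem measure_not_isBalanced_le {Ω : Type*} [MeasurableSpace Ω] {P : Measure Ω}
    {G : Ω → SimpleGraph (Fin N)} {p : unitInterval} (hN : 2 ≤ N) (hp : 0 < p)
    (hG : HasLaw G (SimpleGraph.binomialRandom (Fin N) p) P) (hη : 0 < η) :
    P {ω | ¬ IsBalanced p (G ω) (2 * η / p + 4 / N)} ≤ ENNReal.ofReal (2 / η ^ 4 / N) := by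
  have : (0 : ℝ) < N := by exact_mod_cast (by omega : 0 < N)
  set μ := SimpleGraph.binomialRandom (Fin N) p
  set A : Set (SimpleGraph (Fin N)) := {g | η ^ 4 * (N : ℝ) ^ 4 ≤ gramEnergy (centeredAdj p g)}
  have hsub : {ω | ¬ IsBalanced p (G ω) (2 * η / p + 4 / N)} ⊆ G ⁻¹' A := fun ω hω => by
    by_contra hA
    exact hω (isBalanced_of_gramEnergy_le hN hp _ hη.le (not_le.1 hA).le)
  have hmarkov : η ^ 4 * (N : ℝ) ^ 4 * μ.real A ≤ 2 * (N : ℝ) ^ 3 := by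
    simpa using (mul_meas_ge_le_integral_of_nonneg (μ := μ)
      (f := fun g => gramEnergy (centeredAdj p g)) (.of_forall fun g => gramEnergy_nonneg _)
      .of_finite (η ^ 4 * (N : ℝ) ^ 4)).trans (integral_gramEnergy_centeredAdj_le p)
  have hA : μ.real A ≤ 2 / η ^ 4 / N := by
    rw [div_div, le_div_iff₀ (by positivity)]
    refine le_of_mul_le_mul_left ?_ (by positivity : (0 : ℝ) < (N : ℝ) ^ 3)
    linarith
  calc P {ω | ¬ IsBalanced p (G ω) (2 * η / p + 4 / N)} ≤ P (G ⁻¹' A) := measure_mono hsub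
    _ = μ A := by
        rw [← hG.map_eq, Measure.map_apply_of_aemeasurable hG.aemeasurable
          (Set.toFinite A).measurableSet]
    _ = ENNReal.ofReal (μ.real A) := (ofReal_measureReal).symm
    _ ≤ ENNReal.ofReal (2 / η ^ 4 / N) := ENNReal.ofReal_le_ofReal hA

end Balanced

theorem tendsto_ofReal_const_div_atTop (C : ℝ) :
    Tendsto (fun N : ℕ => ENNReal.ofReal (C / N)) atTop (𝓝 0) := by
  simpa using ENNReal.tendsto_ofReal (tendsto_const_div_atTop_nhds_zero_nat C)

theorem tendsto_measure_not_isBalanced {Ω : ℕ → Type*} [∀ N, MeasurableSpace (Ω N)]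
    {P : ∀ N, Measure (Ω N)} {G : ∀ N, Ω N → SimpleGraph (Fin N)} {p : unitInterval} (hp : 0 < p)
    (hG : ∀ N, HasLaw (G N) (SimpleGraph.binomialRandom (Fin N) p) (P N)) {η : ℝ} (hη : 0 < η) :
    Tendsto (fun N => P N {ω | ¬ IsBalanced p (G N ω) η}) atTop (𝓝 0) := by
  have hp' : 0 < (p : ℝ) := hp
  have hη' : 0 < η * p / 4 := by positivity
  have hsmall : ∀ᶠ N : ℕ in atTop, 4 / (N : ℝ) ≤ η / 2 :=
    (tendsto_const_div_atTop_nhds_zero_nat 4).eventually_le_const (by positivity)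
  refine tendsto_of_tendsto_of_tendsto_of_le_of_le' tendsto_const_nhds
    (tendsto_ofReal_const_div_atTop (2 / (η * p / 4) ^ 4)) (.of_forall fun _ => zero_le) ?_
  filter_upwards [eventually_ge_atTop 2, hsmall] with N hN hN4
  have hle : 2 * (η * p / 4) / p + 4 / N ≤ η := by
    have hhalf : 2 * (η * p / 4) / p = η / 2 := by
      field_simp
      norm_num
    linarith
  have hsub : {ω | ¬ IsBalanced p (G N ω) η} ⊆
      {ω | ¬ IsBalanced p (G N ω) (2 * (η * p / 4) / p + 4 / N)} :=
    fun ω hω hbal => hω (IsBalanced.mono hbal hle)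
  exact (measure_mono hsub).trans (measure_not_isBalanced_le hN hp (hG N) hη')

/-! ### The mean drift of the interacting system -/

theorem norm_le_one_of_mem_stdSimplex {ι : Type*} [Fintype ι] {v : ι → ℝ}
    (hv : v ∈ stdSimplex ℝ ι) : ‖v‖ ≤ 1 :=
  mem_closedBall_zero_iff.1 (stdSimplex_subset_closedBall hv)

theorem norm_le_sum_abs {ι : Type*} [Fintype ι] (v : ι → ℝ) : ‖v‖ ≤ ∑ s, |v s| :=
  (pi_norm_le_iff_of_nonneg (Finset.sum_nonneg fun _ _ => abs_nonneg _)).2 fun s =>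
    Finset.single_le_sum (f := fun s => |v s|) (fun _ _ => abs_nonneg _) (Finset.mem_univ s)

theorem sum_abs_le_card_mul_norm {ι : Type*} [Fintype ι] (v : ι → ℝ) :
    ∑ s, |v s| ≤ Fintype.card ι * ‖v‖ :=
  (Finset.sum_le_sum fun s _ => norm_le_pi_norm v s).trans (by simp)

/-- The mean `(1 / N) ∑_i Q(φ_i) v_i` of the drifts of all vertices, where `φ_i` is the environment
of the vertex `i`. -/
noncomputable def meanDrift {N S : ℕ} (p : ℝ) (q : Fin S → Fin S → (Fin S → ℝ) → ℝ)
    (g : SimpleGraph (Fin N)) (v : Fin N → Fin S → ℝ) : Fin S → ℝ :=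
  average fun i => rateMatrix q (environment p g v i) *ᵥ v i

section MeanDrift

variable {N S : ℕ} {p : ℝ} {q : Fin S → Fin S → (Fin S → ℝ) → ℝ} {g : SimpleGraph (Fin N)}
  {v : Fin N → Fin S → ℝ}

theorem edgeIndicator_nonneg (g : SimpleGraph (Fin N)) (i j : Fin N) :
    0 ≤ edgeIndicator g i j := by
  unfold edgeIndicator
  split_ifs <;> norm_num

theorem edgeIndicator_le_one (g : SimpleGraph (Fin N)) (i j : Fin N) :
    edgeIndicator g i j ≤ 1 := by
  unfold edgeIndicator
  split_ifs <;> norm_num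

theorem environment_apply (p : ℝ) (g : SimpleGraph (Fin N)) (v : Fin N → Fin S → ℝ)
    (i : Fin N) (s : Fin S) : environment p g v i s =
      1 / (((N : ℝ) - 1) * p) * ∑ j, edgeIndicator g i j * v j s := by
  simp [environment, Finset.sum_apply]

theorem environment_eq_sum (p : ℝ) (g : SimpleGraph (Fin N)) (v : Fin N → Fin S → ℝ)
    (i : Fin N) : environment p g v i =
      ∑ j, (1 / (((N : ℝ) - 1) * p) * edgeIndicator g i j) • v j := by
  simp [environment, Finset.smul_sum, smul_smul]

theorem average_apply (v : Fin N → Fin S → ℝ) (s : Fin S) :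
    average v s = 1 / (N : ℝ) * ∑ i, v i s := by
  simp [average, Finset.sum_apply]

theorem norm_average_le (v : Fin N → Fin S → ℝ) : ‖average v‖ ≤ 1 / (N : ℝ) * ∑ i, ‖v i‖ := by
  rw [average, norm_smul, Real.norm_of_nonneg (by positivity)]
  gcongr
  exact norm_sum_le _ _

theorem average_mem_stdSimplex (hN : N ≠ 0) (hv : ∀ i, v i ∈ stdSimplex ℝ (Fin S)) :
    average v ∈ stdSimplex ℝ (Fin S) := by
  have hN' : (N : ℝ) ≠ 0 := Nat.cast_ne_zero.2 hN
  rw [average, Finset.smul_sum]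
  exact (convex_stdSimplex ℝ (Fin S)).sum_mem (fun _ _ => by positivity) (by simp [hN'])
    fun i _ => hv i

theorem norm_environment_le (hN : 2 ≤ N) (hp : 0 < p) (g : SimpleGraph (Fin N))
    (hv : ∀ i, v i ∈ stdSimplex ℝ (Fin S)) (i : Fin N) : ‖environment p g v i‖ ≤ 2 / p := by
  have hN' : (2 : ℝ) ≤ N := by exact_mod_cast hN
  have hN1 : (0 : ℝ) < (N : ℝ) - 1 := by linarith
  rw [environment, norm_smul, Real.norm_of_nonneg (by positivity)]
  calc _ ≤ 1 / (((N : ℝ) - 1) * p) * ∑ _j : Fin N, (1 : ℝ) := by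
        refine mul_le_mul_of_nonneg_left ((norm_sum_le _ _).trans
          (Finset.sum_le_sum fun j _ => ?_)) (by positivity)
        rw [norm_smul, Real.norm_of_nonneg (edgeIndicator_nonneg g i j)]
        exact mul_le_one₀ (edgeIndicator_le_one g i j) (norm_nonneg _)
          (norm_le_one_of_mem_stdSimplex (hv j))
    _ = N / (((N : ℝ) - 1) * p) := by simp [div_eq_inv_mul]
    _ ≤ 2 / p := by
        rw [div_le_div_iff₀ (by positivity) hp]
        nlinarith

theorem IsBalanced.sum_norm_environment_sub_average_le {η : ℝ} (hg : IsBalanced p g η)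
    (hv : ∀ i, v i ∈ stdSimplex ℝ (Fin S)) :
    ∑ i, ‖environment p g v i - average v‖ ≤ S * η * N := by
  calc _ ≤ ∑ i, ∑ s, |(environment p g v i - average v) s| :=
        Finset.sum_le_sum fun i _ => norm_le_sum_abs _
    _ = ∑ s, ∑ i, |environment p g v i s - average v s| := Finset.sum_comm
    _ ≤ ∑ _s : Fin S, η * N := by
        refine Finset.sum_le_sum fun s _ => ?_
        simp_rw [environment_apply, average_apply]
        exact hg (fun i => v i s) fun i =>
          (norm_le_pi_norm (v i) s).trans (norm_le_one_of_mem_stdSimplex (hv i))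
    _ = S * η * N := by simp [mul_assoc]

theorem meanDrift_sub_mulVec_average (p : ℝ) (q : Fin S → Fin S → (Fin S → ℝ) → ℝ)
    (g : SimpleGraph (Fin N)) (v : Fin N → Fin S → ℝ) (A : Matrix (Fin S) (Fin S) ℝ) :
    meanDrift p q g v - A *ᵥ average v =
      average fun i => rateMatrix q (environment p g v i) *ᵥ v i - A *ᵥ v i := by
  simp only [meanDrift, average, Matrix.mulVec_smul, Matrix.mulVec_sum, Finset.sum_sub_distrib,
    smul_sub]

theorem IsBalanced.norm_meanDrift_sub_le {η K : ℝ} (hg : IsBalanced p g η) (hN : 2 ≤ N)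
    (hp : 0 < p) (hp1 : p ≤ 1) (hK : IsRateBound q (2 / p) K)
    (hv : ∀ i, v i ∈ stdSimplex ℝ (Fin S)) :
    ‖meanDrift p q g v - rateMatrix q (average v) *ᵥ average v‖ ≤ K * S * η := by
  have : (0 : ℝ) < N := by exact_mod_cast (by omega : 0 < N)
  have hR : 1 ≤ 2 / p := (one_le_div hp).2 (by linarith)
  have havg : ‖average v‖ ≤ 2 / p :=
    (norm_le_one_of_mem_stdSimplex (average_mem_stdSimplex (by omega) hv)).trans hR
  rw [meanDrift_sub_mulVec_average]
  calc _ ≤ 1 / (N : ℝ) *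
        ∑ i, ‖rateMatrix q (environment p g v i) *ᵥ v i - rateMatrix q (average v) *ᵥ v i‖ :=
        norm_average_le _
    _ ≤ 1 / (N : ℝ) * ∑ i, K * ‖environment p g v i - average v‖ := by
        gcongr with i
        refine (hK.norm_mulVec_sub_le _ _ _ (norm_environment_le hN hp g hv i) havg).trans ?_
        exact mul_le_of_le_one_right (mul_nonneg hK.nonneg (norm_nonneg _))
          (norm_le_one_of_mem_stdSimplex (hv i))
    _ = 1 / (N : ℝ) * (K * ∑ i, ‖environment p g v i - average v‖) := by
        rw [← Finset.mul_sum]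
    _ ≤ 1 / (N : ℝ) * (K * (S * η * N)) := by
        gcongr
        · exact hK.nonneg
        · exact hg.sum_norm_environment_sub_average_le hv
    _ = K * S * η := by field_simp

theorem IsRateBound.norm_drift_sub_le {R K : ℝ} (hK : IsRateBound q R K) (hR : 1 ≤ R)
    {x y : Fin S → ℝ} (hx : x ∈ stdSimplex ℝ (Fin S)) (hy : y ∈ stdSimplex ℝ (Fin S)) :
    ‖rateMatrix q x *ᵥ x - rateMatrix q y *ᵥ y‖ ≤ 2 * K * ‖x - y‖ := by
  have hx1 := norm_le_one_of_mem_stdSimplex hx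
  have hy1 := norm_le_one_of_mem_stdSimplex hy
  have hle : K * ‖x - y‖ * ‖x‖ ≤ K * ‖x - y‖ :=
    mul_le_of_le_one_right (mul_nonneg hK.nonneg (norm_nonneg _)) hx1
  linarith [hK.norm_mulVec_sub_mulVec_le x y (hx1.trans hR) (hy1.trans hR)]

theorem IsMeanFieldSolution.mem_stdSimplex {u : ℝ → Fin S → ℝ} (hu : IsMeanFieldSolution q u)
    (hq_lip : ∀ k s, k ≠ s → LocallyLipschitz (q k s))
    (hq_nonneg : ∀ k s, k ≠ s → ∀ φ : Fin S → ℝ, (∀ l, 0 ≤ φ l) → 0 ≤ q k s φ)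
    {t : ℝ} (ht : 0 ≤ t) : u t ∈ stdSimplex ℝ (Fin S) :=
  mem_stdSimplex_of_interacting_system (ι := Unit) (z := fun t _ => u t) (w := fun _ _ => 1)
    hq_lip hq_nonneg (fun _ _ => zero_le_one) (fun _ => hu.1)
    (fun t ht _ => by simpa using hu.2 t ht) ht ()

theorem IsNIMFASolution.mem_stdSimplex {z : ℝ → Fin N → Fin S → ℝ}
    (hz : IsNIMFASolution p q g z) (hN : 1 ≤ N) (hp : 0 ≤ p)
    (hq_lip : ∀ k s, k ≠ s → LocallyLipschitz (q k s))
    (hq_nonneg : ∀ k s, k ≠ s → ∀ φ : Fin S → ℝ, (∀ l, 0 ≤ φ l) → 0 ≤ q k s φ)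
    {t : ℝ} (ht : 0 ≤ t) (i : Fin N) : z t i ∈ stdSimplex ℝ (Fin S) := by
  have hN' : (1 : ℝ) ≤ N := by exact_mod_cast hN
  have hw (i j : Fin N) : 0 ≤ 1 / (((N : ℝ) - 1) * p) * edgeIndicator g i j :=
    mul_nonneg (one_div_nonneg.2 (mul_nonneg (by linarith) hp)) (edgeIndicator_nonneg g i j)
  exact mem_stdSimplex_of_interacting_system hq_lip hq_nonneg hw hz.1
    (fun t ht i => by simpa only [environment_eq_sum] using hz.2 t ht i) ht i

end MeanDrift

/-! ### Convergence of the NIMFA average -/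

theorem tendstoZeroInProbability_of_forall_ofReal {Ω : ℕ → Type*} [∀ N, MeasurableSpace (Ω N)]
    {P : ∀ N, Measure (Ω N)} {X : ∀ N, Ω N → ℝ≥0∞}
    (h : ∀ ε : ℝ, 0 < ε → Tendsto (fun N => P N {ω | ENNReal.ofReal ε ≤ X N ω}) atTop (𝓝 0)) :
    TendstoZeroInProbability P X := by
  intro ε hε
  have hne : min ε 1 ≠ ∞ := ne_top_of_le_ne_top ENNReal.one_ne_top (min_le_right _ _)
  have hpos : 0 < (min ε 1).toReal :=
    ENNReal.toReal_pos (lt_min hε zero_lt_one).ne' hne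
  refine tendsto_of_tendsto_of_tendsto_of_le_of_le tendsto_const_nhds (h _ hpos)
    (fun _ => zero_le) fun N => measure_mono fun ω hω => ?_
  rw [Set.mem_ofPred_eq, ENNReal.ofReal_toReal hne]
  exact (min_le_left _ _).trans hω

theorem norm_sub_lt_of_dist₁_lt {S : ℕ} {v w : Fin S → ℝ} {a : ℝ}
    (h : dist₁ v w < ENNReal.ofReal a) : ‖v - w‖ < a :=
  (norm_le_sum_abs (v - w)).trans_lt <|
    (ENNReal.ofReal_lt_ofReal_iff_of_nonneg (Finset.sum_nonneg fun _ _ => abs_nonneg _)).1 h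

theorem dist₁_le_of_norm_sub_le {S : ℕ} {v w : Fin S → ℝ} {a : ℝ} (h : ‖v - w‖ ≤ a) :
    dist₁ v w ≤ ENNReal.ofReal (S * a) := by
  refine ENNReal.ofReal_le_ofReal ((sum_abs_le_card_mul_norm (v - w)).trans ?_)
  rw [Fintype.card_fin]
  gcongr

theorem tendstoZeroInProbability_iSup_dist₁ {Ω : ℕ → Type*} [∀ N, MeasurableSpace (Ω N)]
    {P : ∀ N, Measure (Ω N)} {S : ℕ} {x : ∀ N, ℝ → Ω N → Fin S → ℝ} {u : ℝ → Fin S → ℝ}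
    {I : Set ℝ} {C : ℝ} (h : ∀ a : ℝ, 0 < a →
      Tendsto (fun N => P N {ω | ∃ t ∈ I, C * a < ‖x N t ω - u t‖}) atTop (𝓝 0)) :
    TendstoZeroInProbability P fun N ω => ⨆ t ∈ I, dist₁ (x N t ω) (u t) := by
  refine tendstoZeroInProbability_of_forall_ofReal fun ε hε => ?_
  obtain ⟨a, ha, haε⟩ := exists_pos_mul_lt hε (S * C)
  refine tendsto_of_tendsto_of_tendsto_of_le_of_le tendsto_const_nhds (h a ha)
    (fun _ => zero_le) fun N => measure_mono fun ω hω => ?_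
  by_contra hcon
  have hle : ⨆ t ∈ I, dist₁ (x N t ω) (u t) ≤ ENNReal.ofReal (S * C * a) :=
    iSup₂_le fun t ht => by
      rw [mul_assoc]
      exact dist₁_le_of_norm_sub_le (not_lt.1 fun hlt => hcon ⟨t, ht, hlt⟩)
  exact (hle.trans_lt ((ENNReal.ofReal_lt_ofReal_iff hε).2 haε)).not_ge hω

theorem gronwallBound_le_mul_exp {δ K ε x : ℝ} (hK : 0 ≤ K) (hε : 0 ≤ ε) :
    gronwallBound δ K ε x ≤ (δ + ε * x) * Real.exp (K * x) := by
  obtain rfl | hK' := hK.eq_or_lt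
  · simp [gronwallBound_K0]
  have hexp : Real.exp (K * x) - 1 ≤ K * x * Real.exp (K * x) := by
    have hmul := mul_le_mul_of_nonneg_right (Real.one_sub_le_exp_neg (K * x))
      (Real.exp_pos (K * x)).le
    rw [← Real.exp_add, neg_add_cancel, Real.exp_zero] at hmul
    linarith
  calc gronwallBound δ K ε x = δ * Real.exp (K * x) + ε / K * (Real.exp (K * x) - 1) := by
        rw [gronwallBound_of_K_ne_0 hK'.ne']
    _ ≤ δ * Real.exp (K * x) + ε / K * (K * x * Real.exp (K * x)) := by gcongr
    _ = (δ + ε * x) * Real.exp (K * x) := by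
        field_simp

theorem hasDerivWithinAt_average {N S : ℕ} {z : ℝ → Fin N → Fin S → ℝ} {z' : Fin N → Fin S → ℝ}
    {A : Set ℝ} {t : ℝ} (h : ∀ i, HasDerivWithinAt (fun r => z r i) (z' i) A t) :
    HasDerivWithinAt (fun r => average (z r)) (average z') A t :=
  (HasDerivWithinAt.fun_sum fun i _ => h i).const_smul (1 / (N : ℝ))

theorem IsNIMFASolution.norm_average_sub_le {N S : ℕ} {p η K δ T : ℝ}
    {q : Fin S → Fin S → (Fin S → ℝ) → ℝ} {g : SimpleGraph (Fin N)} {z : ℝ → Fin N → Fin S → ℝ}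
    {u : ℝ → Fin S → ℝ} (hz : IsNIMFASolution p q g z) (hu : IsMeanFieldSolution q u)
    (hz_mem : ∀ t, 0 ≤ t → ∀ i, z t i ∈ stdSimplex ℝ (Fin S))
    (hu_mem : ∀ t, 0 ≤ t → u t ∈ stdSimplex ℝ (Fin S)) (hN : 2 ≤ N) (hp : 0 < p) (hp1 : p ≤ 1)
    (hK : IsRateBound q (2 / p) K) (hη : 0 ≤ η) (hg : IsBalanced p g η)
    (hδ : ‖average (z 0) - u 0‖ ≤ δ) {t : ℝ} (ht : t ∈ Set.Icc 0 T) :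
    ‖average (z t) - u t‖ ≤ (δ + K * S * η * T) * Real.exp (2 * K * T) := by
  have hK0 := hK.nonneg
  have hR : 1 ≤ 2 / p := (one_le_div hp).2 (by linarith)
  have hlip : LipschitzOnWith (2 * K).toNNReal (fun x => rateMatrix q x *ᵥ x)
      (stdSimplex ℝ (Fin S)) := LipschitzOnWith.of_dist_le_mul fun x hx y hy => by
    rw [dist_eq_norm, dist_eq_norm, Real.coe_toNNReal _ (by positivity)]
    exact hK.norm_drift_sub_le hR hx hy
  have hz' (r : ℝ) (hr : 0 ≤ r) : HasDerivWithinAt (fun r => average (z r))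
      (meanDrift p q g (z r)) (Set.Ici 0) r := hasDerivWithinAt_average (hz.2 r hr)
  have hgronwall := dist_le_of_approx_trajectories_ODE_of_mem (a := 0) (b := T)
    (fun _ _ => hlip)
    (fun r hr => (hz' r hr.1).continuousWithinAt.mono Set.Icc_subset_Ici_self)
    (fun r hr => (hz' r hr.1).mono (Set.Ici_subset_Ici.2 hr.1))
    (fun r hr => (dist_eq_norm _ _).trans_le
      (hg.norm_meanDrift_sub_le hN hp hp1 hK (hz_mem r hr.1)))
    (fun r hr => average_mem_stdSimplex (by omega) (hz_mem r hr.1))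
    (fun r hr => (hu.2 r hr.1).continuousWithinAt.mono Set.Icc_subset_Ici_self)
    (fun r hr => (hu.2 r hr.1).mono (Set.Ici_subset_Ici.2 hr.1))
    (fun r _ => (dist_self _).le) (fun r hr => hu_mem r hr.1)
    ((dist_eq_norm _ _).trans_le hδ) t ht
  rw [dist_eq_norm, sub_zero, add_zero, Real.coe_toNNReal _ (by positivity)] at hgronwall
  calc _ ≤ gronwallBound δ (2 * K) (K * S * η) t := hgronwall
    _ ≤ gronwallBound δ (2 * K) (K * S * η) T :=
        gronwallBound_mono ((norm_nonneg _).trans hδ) (by positivity) (by positivity) ht.2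
    _ ≤ _ := gronwallBound_le_mul_exp (by positivity) (by positivity)

theorem tendstoZeroInProbability_nimfa {S : ℕ} {q : Fin S → Fin S → (Fin S → ℝ) → ℝ}
    (hq_lip : ∀ k s, k ≠ s → LocallyLipschitz (q k s))
    (hq_nonneg : ∀ k s, k ≠ s → ∀ φ : Fin S → ℝ, (∀ l, 0 ≤ φ l) → 0 ≤ q k s φ)
    {p : unitInterval} (hp : 0 < p)
    {Ω : ℕ → Type*} [∀ N, MeasurableSpace (Ω N)] {P : ∀ N, Measure (Ω N)}
    {G : ∀ N, Ω N → SimpleGraph (Fin N)}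
    (hG : ∀ N, HasLaw (G N) (SimpleGraph.binomialRandom (Fin N) p) (P N))
    {z : ∀ N, Ω N → ℝ → Fin N → Fin S → ℝ}
    (hz : ∀ N, ∀ᵐ ω ∂(P N), IsNIMFASolution p q (G N ω) (z N ω))
    {u : ℝ → Fin S → ℝ} (hu : IsMeanFieldSolution q u)
    (h0 : TendstoZeroInProbability P fun N ω => dist₁ (average (z N ω 0)) (u 0)) (T : ℝ) :
    TendstoZeroInProbability P fun N ω =>
      ⨆ t ∈ Set.Icc (0 : ℝ) T, dist₁ (average (z N ω t)) (u t) := by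
  have hp' : 0 < (p : ℝ) := hp
  obtain ⟨K, hK⟩ := exists_isRateBound hq_lip (2 / p)
  refine tendstoZeroInProbability_iSup_dist₁ (x := fun N t ω => average (z N ω t))
    (C := (1 + K * S * T) * Real.exp (2 * K * T)) fun a ha => ?_
  have hlim := (h0 (ENNReal.ofReal a) (ENNReal.ofReal_pos.2 ha)).add
    (tendsto_measure_not_isBalanced hp hG ha)
  rw [add_zero] at hlim
  refine tendsto_of_tendsto_of_tendsto_of_le_of_le' tendsto_const_nhds hlim
    (.of_forall fun _ => zero_le) ?_
  filter_upwards [eventually_ge_atTop 2] with N hN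
  refine (measure_mono_ae ?_).trans (measure_union_le _ _)
  filter_upwards [hz N] with ω hω ⟨t, ht, hlarge⟩
  by_contra hgood
  obtain ⟨hinit, hbal⟩ := not_or.1 hgood
  refine hlarge.not_ge ((hω.norm_average_sub_le hu
    (fun r hr => hω.mem_stdSimplex (by omega) hp'.le hq_lip hq_nonneg hr)
    (fun r hr => hu.mem_stdSimplex hq_lip hq_nonneg hr) hN hp' p.2.2 hK ha.le (not_not.1 hbal)
    (norm_sub_lt_of_dist₁_lt (not_le.1 hinit)).le ht).trans_eq ?_)
  ring

/-! ### A maximal inequality for compensated processes -/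

section Maximal

variable {Ω : Type*} {m0 : MeasurableSpace Ω} {μ : Measure Ω}

theorem integral_sub_condExp_sq [IsFiniteMeasure μ] {m : MeasurableSpace Ω} (hm : m ≤ m0)
    {X : Ω → ℝ} (hX : MemLp X 2 μ) :
    ∫ ω, (X ω - (μ[X | m]) ω) ^ 2 ∂μ = ∫ ω, X ω ^ 2 ∂μ - ∫ ω, (μ[X | m]) ω ^ 2 ∂μ := by
  have hcond : MemLp (μ[X | m]) 2 μ := hX.condExp one_le_two
  calc ∫ ω, (X ω - (μ[X | m]) ω) ^ 2 ∂μ = ∫ ω, (Var[X; μ | m]) ω ∂μ :=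
        (integral_condExp hm).symm
    _ = ∫ ω, ((μ[X ^ 2 | m]) ω - (μ[X | m]) ω ^ 2) ∂μ :=
        integral_congr_ae (condVar_ae_eq_condExp_sq_sub_sq_condExp hm hX)
    _ = _ := by
        rw [integral_sub integrable_condExp hcond.integrable_sq, integral_condExp hm]
        rfl

variable [IsFiniteMeasure μ] {ℱ : Filtration ℕ m0} {M X : ℕ → Ω → ℝ}

theorem submartingale_sq_of_martingale (hM : Martingale M ℱ μ) (hM2 : ∀ n, MemLp (M n) 2 μ) :
    Submartingale (fun n ω => M n ω ^ 2) ℱ μ := by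
  refine submartingale_nat (fun n => (hM.stronglyAdapted n).pow 2)
    (fun n => (hM2 n).integrable_sq) fun n => ?_
  have hjensen := (even_two.convexOn_pow (𝕜 := ℝ)).map_condExp_le_univ (ℱ.le n)
    (continuous_pow 2).lowerSemicontinuous ((hM2 (n + 1)).integrable one_le_two)
    (hM2 (n + 1)).integrable_sq
  filter_upwards [hjensen, hM.condExp_ae_eq n.le_succ] with ω hω hcond
  rwa [Function.comp_apply, hcond] at hω

theorem integral_sq_eq_sum_of_martingale (hM : Martingale M ℱ μ) (hM2 : ∀ n, MemLp (M n) 2 μ)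
    (hM0 : M 0 = 0) (n : ℕ) :
    ∫ ω, M n ω ^ 2 ∂μ = ∑ j ∈ Finset.range n, ∫ ω, (M (j + 1) ω - M j ω) ^ 2 ∂μ := by
  have hincr (j : ℕ) : ∫ ω, (M (j + 1) ω - M j ω) ^ 2 ∂μ =
      ∫ ω, M (j + 1) ω ^ 2 ∂μ - ∫ ω, M j ω ^ 2 ∂μ := by
    have hcond := hM.condExp_ae_eq j.le_succ
    rw [← integral_congr_ae (hcond.mono fun ω hω => congrArg (· ^ 2) hω),
      ← integral_sub_condExp_sq (ℱ.le j) (hM2 (j + 1))]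
    exact integral_congr_ae (hcond.mono fun ω hω => congrArg (fun r => (M (j + 1) ω - r) ^ 2)
      hω.symm)
  simp [hincr, Finset.sum_range_sub (fun j => ∫ ω, M j ω ^ 2 ∂μ), hM0]

theorem measure_exists_le_abs_le_of_martingale (hM : Martingale M ℱ μ)
    (hM2 : ∀ n, MemLp (M n) 2 μ) {ε : ℝ} (hε : 0 < ε) (m : ℕ) :
    μ {ω | ∃ k ≤ m, ε ≤ |M k ω|} ≤ ENNReal.ofReal ((∫ ω, M m ω ^ 2 ∂μ) / ε ^ 2) := by
  have hε2 : 0 < ε ^ 2 := by positivity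
  have hmax := maximal_ineq (submartingale_sq_of_martingale hM hM2)
    (fun k ω => sq_nonneg _) (ε := (ε ^ 2).toNNReal) m
  rw [Real.coe_toNNReal _ hε2.le] at hmax
  have hsub : {ω | ∃ k ≤ m, ε ≤ |M k ω|} ⊆
      {ω | ε ^ 2 ≤ (Finset.range (m + 1)).sup' Finset.nonempty_range_add_one
        fun k => M k ω ^ 2} := by
    rintro ω ⟨k, hk, hle⟩
    refine le_trans ?_ (Finset.le_sup' (fun k => M k ω ^ 2)
      (Finset.mem_range.2 (Nat.lt_succ_of_le hk)))
    rw [← sq_abs (M k ω)]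
    gcongr
  refine (measure_mono hsub).trans ?_
  rw [ENNReal.ofReal_div_of_pos hε2, ENNReal.le_div_iff_mul_le (Or.inl (by simpa using hε.ne'))
    (Or.inl ENNReal.ofReal_ne_top), mul_comm]
  exact hmax.trans (ENNReal.ofReal_le_ofReal (setIntegral_le_integral (hM2 m).integrable_sq
    (Eventually.of_forall fun ω => sq_nonneg _)))

theorem measure_exists_le_abs_sub_predictablePart_le (hadp : StronglyAdapted ℱ X)
    (hX : ∀ n, MemLp (X n) 2 μ) {ε : ℝ} (hε : 0 < ε) (m : ℕ) :
    μ {ω | ∃ k ≤ m, ε ≤ |X k ω - X 0 ω - predictablePart X ℱ μ k ω|} ≤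
      ENNReal.ofReal ((∑ j ∈ Finset.range m, ∫ ω, (X (j + 1) ω - X j ω) ^ 2 ∂μ) / ε ^ 2) := by
  have hint (n : ℕ) : Integrable (X n) μ := (hX n).integrable one_le_two
  set M : ℕ → Ω → ℝ := fun k ω => X k ω - X 0 ω - predictablePart X ℱ μ k ω
  have hM_eq : M = martingalePart X ℱ μ - fun _ => X 0 := by
    ext k ω
    simp [M, martingalePart, sub_right_comm]
  have hM : Martingale M ℱ μ := hM_eq ▸ (martingale_martingalePart hadp hint).sub
    (martingale_const_fun ℱ μ (hadp 0) (hint 0))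
  have hpred (n : ℕ) : MemLp (predictablePart X ℱ μ n) 2 μ :=
    memLp_finsetSum' _ fun j _ => ((hX _).sub (hX _)).condExp one_le_two
  have hM2 (n : ℕ) : MemLp (M n) 2 μ := ((hX n).sub (hX 0)).sub (hpred n)
  have hincr (j : ℕ) : ∫ ω, (M (j + 1) ω - M j ω) ^ 2 ∂μ ≤ ∫ ω, (X (j + 1) ω - X j ω) ^ 2 ∂μ := by
    have hpyth := integral_sub_condExp_sq (ℱ.le j) ((hX (j + 1)).sub (hX j))
    simp only [Pi.sub_apply] at hpyth
    calc ∫ ω, (M (j + 1) ω - M j ω) ^ 2 ∂μ =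
          ∫ ω, (X (j + 1) ω - X j ω - (μ[X (j + 1) - X j | ℱ j]) ω) ^ 2 ∂μ := by
          refine integral_congr_ae (Eventually.of_forall fun ω => ?_)
          simp only [M, predictablePart_add_one, Pi.add_apply]
          ring
      _ ≤ _ := hpyth.trans_le (sub_le_self _ (integral_nonneg fun ω => sq_nonneg _))
  refine (measure_exists_le_abs_le_of_martingale hM hM2 hε m).trans (ENNReal.ofReal_le_ofReal ?_)
  rw [integral_sq_eq_sum_of_martingale hM hM2 (by ext; simp [M])]
  exact div_le_div_of_nonneg_right (Finset.sum_le_sum fun j _ => hincr j) (sq_nonneg ε)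

end Maximal

/-! ### The exact system over a short time -/

section Exp

attribute [local instance] Matrix.linftyOpNormedRing Matrix.linftyOpNormedAlgebra

theorem eventually_norm_matrix_exp_mulVec_sub_le {ι α : Type*} [Finite ι] [Fintype α]
    [DecidableEq α] (A : ι → Matrix α α ℝ) {κ : ℝ} (hκ : 0 < κ) :
    ∀ᶠ t : ℝ in 𝓝[>] 0, ∀ i (f : α → ℝ),
      ‖NormedSpace.exp (t • A i) *ᵥ f - (f + t • A i *ᵥ f)‖ ≤ κ * t * ‖f‖ := by
  refine eventually_all.2 fun i => ?_
  have hderiv := hasDerivAt_exp_smul_const (A i) (0 : ℝ)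
  rw [zero_smul, NormedSpace.exp_zero, one_mul] at hderiv
  filter_upwards [nhdsWithin_le_nhds ((hasDerivAt_iff_isLittleO.1 hderiv).bound hκ),
    self_mem_nhdsWithin] with t ht ht0 f
  rw [zero_smul, NormedSpace.exp_zero, sub_zero, Real.norm_of_nonneg (le_of_lt ht0)] at ht
  calc ‖NormedSpace.exp (t • A i) *ᵥ f - (f + t • A i *ᵥ f)‖ =
        ‖(NormedSpace.exp (t • A i) - 1 - t • A i) *ᵥ f‖ := by
        rw [Matrix.sub_mulVec, Matrix.sub_mulVec, Matrix.one_mulVec, Matrix.smul_mulVec, sub_sub]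
    _ ≤ ‖NormedSpace.exp (t • A i) - 1 - t • A i‖ * ‖f‖ := Matrix.linfty_opNorm_mulVec _ _
    _ ≤ κ * t * ‖f‖ := mul_le_mul_of_nonneg_right ht (norm_nonneg f)

end Exp

section Generator

variable {N S : ℕ} {p : ℝ} {q : Fin S → Fin S → (Fin S → ℝ) → ℝ}

theorem generator_mulVec_apply (g : SimpleGraph (Fin N)) (f : Config N S → ℝ) (c : Config N S) :
    (generator p q g *ᵥ f) c = ∑ i, ∑ k ∈ Finset.univ.erase (c i),
      q k (c i) (environment p g (indicators c) i) * (f (Function.update c i k) - f c) := by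
  calc (generator p q g *ᵥ f) c = ∑ c', jumpRate p q g c c' * (f c' - f c) := by
        simp_rw [mul_sub, Finset.sum_sub_distrib, ← Finset.sum_mul]
        rw [generator, Matrix.sub_mulVec, Pi.sub_apply, Matrix.mulVec_diagonal]
        rfl
    _ = _ := by
        simp_rw [jumpRate, Finset.sum_mul]
        rw [Finset.sum_comm]
        refine Finset.sum_congr rfl fun i _ => ?_
        rw [Finset.sum_comm]
        simp

/-- The fraction of vertices in each state: the empirical distribution `x` of a configuration. -/
noncomputable abbrev density (c : Config N S) : Fin S → ℝ := average (indicators c)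

theorem indicators_mem_stdSimplex (c : Config N S) (i : Fin N) :
    indicators c i ∈ stdSimplex ℝ (Fin S) :=
  single_mem_stdSimplex ℝ (c i)

theorem density_update_sub (c : Config N S) (i : Fin N) (k l : Fin S) :
    density (Function.update c i k) l - density c l =
      1 / (N : ℝ) * ((if l = k then 1 else 0) - if l = c i then 1 else 0) := by
  rw [density, density, average_apply, average_apply, ← mul_sub, ← Finset.sum_sub_distrib,
    Finset.sum_eq_single i]
  · simp [indicators, Pi.single_apply]
  · intro j _ hj
    simp [indicators, Function.update_of_ne hj]
  · simp

theorem abs_density_sub_le_one (c c' : Config N S) (l : Fin S) :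
    |density c' l - density c l| ≤ 1 := by
  obtain rfl | hN := eq_or_ne N 0
  · simp [Subsingleton.elim c c']
  have hmem (c : Config N S) : 0 ≤ density c l ∧ density c l ≤ 1 :=
    mem_Icc_of_mem_stdSimplex (average_mem_stdSimplex hN (indicators_mem_stdSimplex c)) l
  rw [abs_le]
  constructor <;> linarith [(hmem c).1, (hmem c).2, (hmem c').1, (hmem c').2]

theorem generator_mulVec_density (g : SimpleGraph (Fin N)) (c : Config N S) (l : Fin S) :
    (generator p q g *ᵥ fun c' => density c' l) c = meanDrift p q g (indicators c) l := by
  rw [generator_mulVec_apply, meanDrift, average_apply, Finset.mul_sum]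
  refine Finset.sum_congr rfl fun i _ => ?_
  simp only [density_update_sub, mul_left_comm _ (1 / (N : ℝ)), ← Finset.mul_sum]
  rw [indicators, Matrix.mulVec_single_one, Matrix.col_apply]
  congr 1
  obtain rfl | h := eq_or_ne l (c i)
  · rw [rateMatrix_apply_self, ← Finset.sum_neg_distrib]
    refine Finset.sum_congr rfl fun k hk => ?_
    simp [(Finset.ne_of_mem_erase hk).symm]
  · simp [h, rateMatrix_apply_of_ne q _ h]

theorem IsRateBound.generator_mulVec_density_sub_sq_le {K : ℝ} (hK : IsRateBound q (2 / p) K)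
    (hN : 2 ≤ N) (hp : 0 < p) (g : SimpleGraph (Fin N)) (c : Config N S) (l : Fin S) :
    (generator p q g *ᵥ fun c' => (density c' l - density c l) ^ 2) c ≤ S * K / N := by
  have hK0 := hK.nonneg
  have hjump (i : Fin N) {k : Fin S} (hk : k ≠ c i) :
      q k (c i) (environment p g (indicators c) i) *
        (density (Function.update c i k) l - density c l) ^ 2 ≤ K * (1 / (N : ℝ)) ^ 2 := by
    have hrate := (le_abs_self _).trans
      (hK.abs_rate_le hk (norm_environment_le hN hp g (indicators_mem_stdSimplex c) i))
    have hsize : (density (Function.update c i k) l - density c l) ^ 2 ≤ (1 / (N : ℝ)) ^ 2 := by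
      rw [density_update_sub, mul_pow]
      refine mul_le_of_le_one_right (by positivity) ?_
      split_ifs <;> norm_num
    exact mul_le_mul hrate hsize (sq_nonneg _) hK0
  calc (generator p q g *ᵥ fun c' => (density c' l - density c l) ^ 2) c
      = ∑ i, ∑ k ∈ Finset.univ.erase (c i), q k (c i) (environment p g (indicators c) i) *
          (density (Function.update c i k) l - density c l) ^ 2 := by
        simp [generator_mulVec_apply]
    _ ≤ ∑ i : Fin N, ∑ _k ∈ Finset.univ.erase (c i), K * (1 / (N : ℝ)) ^ 2 :=
        Finset.sum_le_sum fun i _ => Finset.sum_le_sum fun k hk =>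
          hjump i (Finset.ne_of_mem_erase hk)
    _ ≤ ∑ _i : Fin N, ∑ _k : Fin S, K * (1 / (N : ℝ)) ^ 2 :=
        Finset.sum_le_sum fun i _ => Finset.sum_le_sum_of_subset_of_nonneg
          (Finset.erase_subset (c i) _) fun _ _ _ => by positivity
    _ = S * K / N := by
        simp only [Finset.sum_const, Finset.card_univ, Fintype.card_fin, nsmul_eq_mul]
        field_simp

end Generator

section Markov

variable {Ω : Type*} {N S : ℕ} {G : Ω → SimpleGraph (Fin N)} {σ : ℝ → Ω → Config N S}

theorem past_mono {s t : ℝ} (hst : s ≤ t) : past G σ s ≤ past G σ t :=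
  sup_le_sup_left (biSup_mono fun _ hr => ⟨hr.1, hr.2.trans hst⟩) _

theorem measurable_process_past {r s : ℝ} (hr : r ∈ Set.Icc 0 s) :
    Measurable[past G σ s] (σ r) :=
  (comap_measurable (σ r)).mono
    ((le_biSup (fun r => MeasurableSpace.comap (σ r) inferInstance) hr).trans le_sup_right) le_rfl

variable [mΩ : MeasurableSpace Ω] {p : ℝ} {q : Fin S → Fin S → (Fin S → ℝ) → ℝ} {P : Measure Ω}

theorem integrable_comp_of_finite [IsFiniteMeasure P] {α : Type*} [Finite α] [MeasurableSpace α]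
    [MeasurableSingletonClass α] {Z : Ω → α} (hZ : Measurable Z) (f : α → ℝ) :
    Integrable (fun ω => f (Z ω)) P :=
  (Integrable.of_finite (f := f) (μ := P.map Z)).comp_measurable hZ

namespace IsExactSystem

theorem past_le (hσ : IsExactSystem p q P G σ) (s : ℝ) : past G σ s ≤ mΩ :=
  sup_le hσ.measurable_graph.comap_le
    (iSup₂_le fun r hr => (hσ.measurable_process r hr.1).comap_le)

variable [IsFiniteMeasure P]

theorem condExp_comp_ae_eq (hσ : IsExactSystem p q P G σ) {s t : ℝ} (hs : 0 ≤ s) (ht : 0 ≤ t)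
    (f : Config N S → Config N S → ℝ) :
    P[fun ω => f (σ s ω) (σ (s + t) ω) | past G σ s] =ᵐ[P]
      fun ω => (NormedSpace.exp (t • generator p q (G ω)) *ᵥ f (σ s ω)) (σ s ω) := by
  have hσs := hσ.measurable_process s hs
  have hσt := hσ.measurable_process (s + t) (add_nonneg hs ht)
  set J : Config N S → Ω → ℝ := fun c ω => if σ (s + t) ω = c then 1 else 0
  have hdecomp : (fun ω => f (σ s ω) (σ (s + t) ω)) = ∑ c, (fun ω => f (σ s ω) c) * J c := by
    ext ω
    simp [J, Finset.sum_apply]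
  have hJ (c : Config N S) : Integrable (J c) P :=
    integrable_comp_of_finite hσt fun c' => if c' = c then 1 else 0
  have hfJ (c : Config N S) : Integrable ((fun ω => f (σ s ω) c) * J c) P :=
    integrable_comp_of_finite (hσs.prodMk hσt) fun x => f x.1 c * if x.2 = c then 1 else 0
  have hf (c : Config N S) : StronglyMeasurable[past G σ s] fun ω => f (σ s ω) c :=
    ((Measurable.of_discrete (f := fun c' => f c' c)).comp
      (measurable_process_past (G := G) ⟨hs, le_rfl⟩)).stronglyMeasurable
  have hterm (c : Config N S) : P[(fun ω => f (σ s ω) c) * J c | past G σ s] =ᵐ[P]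
      fun ω => f (σ s ω) c * NormedSpace.exp (t • generator p q (G ω)) (σ s ω) c := by
    refine (condExp_mul_of_stronglyMeasurable_left (hf c) (hfJ c) (hJ c)).trans ?_
    filter_upwards [hσ.markov s t hs ht c] with ω hω
    rw [Pi.mul_apply, hω]
  rw [hdecomp]
  refine (condExp_finsetSum (fun c _ => hfJ c) _).trans ?_
  filter_upwards [eventually_all.2 hterm] with ω hω
  rw [Finset.sum_apply]
  exact Finset.sum_congr rfl fun c _ => (hω c).trans (mul_comm _ _)

theorem eventually_abs_condExp_sub_generator_le (hσ : IsExactSystem p q P G σ) {κ : ℝ}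
    (hκ : 0 < κ) :
    ∀ᶠ t : ℝ in 𝓝[>] 0, ∀ s, 0 ≤ s → ∀ f : Config N S → Config N S → ℝ, (∀ c, f c c = 0) →
      (∀ c c', |f c c'| ≤ 1) → ∀ᵐ ω ∂P, |(P[fun ω => f (σ s ω) (σ (s + t) ω) | past G σ s]) ω -
        t * (generator p q (G ω) *ᵥ f (σ s ω)) (σ s ω)| ≤ κ * t := by
  filter_upwards [eventually_norm_matrix_exp_mulVec_sub_le (generator (N := N) (S := S) p q) hκ,
    self_mem_nhdsWithin] with t hexp ht0 s hs f hf0 hf1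
  have ht : 0 ≤ t := le_of_lt ht0
  filter_upwards [hσ.condExp_comp_ae_eq hs ht f] with ω hω
  rw [hω]
  calc |(NormedSpace.exp (t • generator p q (G ω)) *ᵥ f (σ s ω)) (σ s ω) -
        t * (generator p q (G ω) *ᵥ f (σ s ω)) (σ s ω)|
      = ‖(NormedSpace.exp (t • generator p q (G ω)) *ᵥ f (σ s ω) -
          (f (σ s ω) + t • generator p q (G ω) *ᵥ f (σ s ω))) (σ s ω)‖ := by
        simp [hf0, Real.norm_eq_abs]
    _ ≤ κ * t * ‖f (σ s ω)‖ := (norm_le_pi_norm _ _).trans (hexp (G ω) (f (σ s ω)))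
    _ ≤ κ * t := mul_le_of_le_one_right (by positivity)
        ((pi_norm_le_iff_of_nonneg zero_le_one).2 (hf1 (σ s ω)))

theorem eventually_abs_condExp_density_sub_le (hσ : IsExactSystem p q P G σ) {κ : ℝ}
    (hκ : 0 < κ) :
    ∀ᶠ t : ℝ in 𝓝[>] 0, ∀ s, 0 ≤ s → ∀ l : Fin S, ∀ᵐ ω ∂P,
      |(P[fun ω => density (σ (s + t) ω) l - density (σ s ω) l | past G σ s]) ω -
        t * meanDrift p q (G ω) (indicators (σ s ω)) l| ≤ κ * t := by
  filter_upwards [hσ.eventually_abs_condExp_sub_generator_le hκ] with t ht s hs l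
  have hgen (g : SimpleGraph (Fin N)) (c : Config N S) :
      (generator p q g *ᵥ fun c' => density c' l - density c l) c =
        meanDrift p q g (indicators c) l := by
    rw [← generator_mulVec_density, generator_mulVec_apply, generator_mulVec_apply]
    simp
  simpa only [hgen] using ht s hs (fun c c' => density c' l - density c l)
    (fun c => sub_self _) (fun c c' => abs_density_sub_le_one c c' l)

end IsExactSystem

theorem IsExactSystem.eventually_integral_density_sub_sq_le [IsProbabilityMeasure P]
    (hσ : IsExactSystem p q P G σ) (hN : 2 ≤ N) (hp : 0 < p) {K : ℝ}
    (hK : IsRateBound q (2 / p) K) {κ : ℝ} (hκ : 0 < κ) :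
    ∀ᶠ t : ℝ in 𝓝[>] 0, ∀ s, 0 ≤ s → ∀ l : Fin S,
      ∫ ω, (density (σ (s + t) ω) l - density (σ s ω) l) ^ 2 ∂P ≤ (S * K / N + κ) * t := by
  filter_upwards [hσ.eventually_abs_condExp_sub_generator_le hκ, self_mem_nhdsWithin]
    with t ht ht0 s hs l
  rw [← integral_condExp (hσ.past_le s)]
  refine (integral_mono_ae integrable_condExp (integrable_const ((S * K / N + κ) * t))
    ?_).trans_eq (by simp)
  filter_upwards [ht s hs (fun c c' => (density c' l - density c l) ^ 2) (by simp)
    fun c c' => by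
      rw [abs_pow]
      exact pow_le_one₀ (abs_nonneg _) (abs_density_sub_le_one c c' l)] with ω hω
  have hgen := mul_le_mul_of_nonneg_left
    (hK.generator_mulVec_density_sub_sq_le hN hp (G ω) (σ s ω) l) (le_of_lt ht0)
  linarith [(abs_le.1 hω).2]

end Markov

/-! ### Comparison along a grid -/

theorem le_mul_one_add_pow_of_le_sum {e : ℕ → ℝ} {A b : ℝ} {m : ℕ} (hb : 0 ≤ b)
    (he : ∀ k ≤ m, e k ≤ A + b * ∑ j ∈ Finset.range k, e j) {k : ℕ} (hk : k ≤ m) :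
    e k ≤ A * (1 + b) ^ k := by
  refine (he k hk).trans ?_
  induction k with
  | zero => simp
  | succ k ih =>
    have hstep := mul_le_mul_of_nonneg_left (he k (by omega)) hb
    calc A + b * ∑ j ∈ Finset.range (k + 1), e j
        ≤ (A + b * ∑ j ∈ Finset.range k, e j) * (1 + b) := by
          rw [Finset.sum_range_succ]
          linarith
      _ ≤ A * (1 + b) ^ k * (1 + b) := by
          gcongr
          exact ih (by omega)
      _ = A * (1 + b) ^ (k + 1) := by ring

section Euler

variable {E : Type*} [NormedAddCommGroup E] [NormedSpace ℝ E] {x u B C : ℕ → E}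
  {h a r r' d L : ℝ} {m : ℕ}

theorem norm_sub_le_add_sum_of_approx_euler (hh : 0 ≤ h) (hd : 0 ≤ d) (h0 : ‖x 0 - u 0‖ ≤ a)
    (hx : ∀ k ≤ m, ‖x k - x 0 - ∑ j ∈ Finset.range k, h • B j‖ ≤ r)
    (hu : ∀ k ≤ m, ‖u k - u 0 - ∑ j ∈ Finset.range k, h • C j‖ ≤ r')
    (hBC : ∀ j < m, ‖B j - C j‖ ≤ L * ‖x j - u j‖ + d) {k : ℕ} (hk : k ≤ m) :
    ‖x k - u k‖ ≤ (a + r + r' + m * h * d) + h * L * ∑ j ∈ Finset.range k, ‖x j - u j‖ := by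
  have hdecomp : x k - u k = (x 0 - u 0) + (x k - x 0 - ∑ j ∈ Finset.range k, h • B j) -
      (u k - u 0 - ∑ j ∈ Finset.range k, h • C j) + ∑ j ∈ Finset.range k, h • (B j - C j) := by
    simp only [smul_sub, Finset.sum_sub_distrib]
    abel
  have hsum : ‖∑ j ∈ Finset.range k, h • (B j - C j)‖ ≤
      h * L * ∑ j ∈ Finset.range k, ‖x j - u j‖ + m * h * d := by
    calc _ ≤ ∑ j ∈ Finset.range k, h * (L * ‖x j - u j‖ + d) := by
          refine norm_sum_le_of_le _ fun j hj => ?_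
          rw [norm_smul, Real.norm_of_nonneg hh]
          gcongr
          exact hBC j ((Finset.mem_range.1 hj).trans_le hk)
      _ = h * L * ∑ j ∈ Finset.range k, ‖x j - u j‖ + k * h * d := by
          simp only [mul_add, Finset.sum_add_distrib, Finset.mul_sum, mul_assoc, Finset.sum_const,
            Finset.card_range, nsmul_eq_mul]
      _ ≤ _ := by gcongr
  rw [hdecomp]
  refine (norm_add_le _ _).trans ((add_le_add ((norm_sub_le _ _).trans
    (add_le_add (norm_add_le _ _) (hu k hk))) hsum).trans ?_)
  linarith [hx k hk]

theorem norm_sub_le_mul_exp_of_approx_euler (hh : 0 ≤ h) (hL : 0 ≤ L) (hd : 0 ≤ d)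
    (h0 : ‖x 0 - u 0‖ ≤ a)
    (hx : ∀ k ≤ m, ‖x k - x 0 - ∑ j ∈ Finset.range k, h • B j‖ ≤ r)
    (hu : ∀ k ≤ m, ‖u k - u 0 - ∑ j ∈ Finset.range k, h • C j‖ ≤ r')
    (hBC : ∀ j < m, ‖B j - C j‖ ≤ L * ‖x j - u j‖ + d) {k : ℕ} (hk : k ≤ m) :
    ‖x k - u k‖ ≤ (a + r + r' + m * h * d) * Real.exp (L * (m * h)) := by
  have ha : 0 ≤ a := (norm_nonneg _).trans h0
  have hr : 0 ≤ r := (norm_nonneg _).trans (hx 0 m.zero_le)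
  have hr' : 0 ≤ r' := (norm_nonneg _).trans (hu 0 m.zero_le)
  have hpow : (1 + h * L) ^ k ≤ Real.exp (L * (m * h)) :=
    calc (1 + h * L) ^ k ≤ Real.exp (h * L) ^ k := by
          gcongr
          linarith [Real.add_one_le_exp (h * L)]
      _ = Real.exp (L * (k * h)) := by
          rw [← Real.exp_nat_mul]
          ring_nf
      _ ≤ Real.exp (L * (m * h)) := by gcongr
  exact (le_mul_one_add_pow_of_le_sum (by positivity)
    (fun k hk => norm_sub_le_add_sum_of_approx_euler hh hd h0 hx hu hBC hk) hk).trans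
    (mul_le_mul_of_nonneg_left hpow (by positivity))

end Euler

section MeanField

variable {S : ℕ} {q : Fin S → Fin S → (Fin S → ℝ) → ℝ} {R K h : ℝ} {u : ℝ → Fin S → ℝ}

namespace IsMeanFieldSolution

theorem norm_sub_sub_smul_le (hu : IsMeanFieldSolution q u)
    (hu_mem : ∀ t, 0 ≤ t → u t ∈ stdSimplex ℝ (Fin S)) (hK : IsRateBound q R K) (hR : 1 ≤ R)
    {t : ℝ} (ht : 0 ≤ t) (hh : 0 ≤ h) :
    ‖u (t + h) - u t - h • (rateMatrix q (u t) *ᵥ u t)‖ ≤ 2 * K ^ 2 * h * h := by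
  have hK0 := hK.nonneg
  have hderiv : ∀ r ∈ Set.Icc t (t + h), HasDerivWithinAt u (rateMatrix q (u r) *ᵥ u r)
      (Set.Icc t (t + h)) r := fun r hr =>
    (hu.2 r (ht.trans hr.1)).mono fun y hy => ht.trans hy.1
  have hlip : ∀ r ∈ Set.Icc t (t + h), ‖u r - u t‖ ≤ K * (r - t) :=
    norm_image_sub_le_of_norm_deriv_le_segment' hderiv fun r hr => by
      have hur := norm_le_one_of_mem_stdSimplex (hu_mem r (ht.trans hr.1))
      exact (hK.norm_mulVec_le _ _ (hur.trans hR)).trans (mul_le_of_le_one_right hK0 hur)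
  have hderiv_sub : ∀ r ∈ Set.Icc t (t + h),
      HasDerivWithinAt (fun r => u r - (r - t) • (rateMatrix q (u t) *ᵥ u t))
        (rateMatrix q (u r) *ᵥ u r - (1 : ℝ) • (rateMatrix q (u t) *ᵥ u t))
        (Set.Icc t (t + h)) r := fun r hr =>
    (hderiv r hr).sub (((hasDerivWithinAt_id r _).sub_const t).smul_const _)
  have hbound : ∀ r ∈ Set.Ico t (t + h),
      ‖rateMatrix q (u r) *ᵥ u r - (1 : ℝ) • (rateMatrix q (u t) *ᵥ u t)‖ ≤ 2 * K ^ 2 * h := by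
    intro r hr
    rw [one_smul]
    calc _ ≤ 2 * K * ‖u r - u t‖ :=
          hK.norm_drift_sub_le hR (hu_mem r (ht.trans hr.1)) (hu_mem t ht)
      _ ≤ 2 * K * (K * (r - t)) := by
          gcongr
          exact hlip r ⟨hr.1, hr.2.le⟩
      _ ≤ 2 * K * (K * h) := by
          gcongr
          linarith [hr.2]
      _ = 2 * K ^ 2 * h := by ring
  have hend := norm_image_sub_le_of_norm_deriv_le_segment' hderiv_sub hbound (t + h)
    ⟨by linarith, le_rfl⟩
  rw [sub_self, zero_smul, sub_zero, add_sub_cancel_left] at hend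
  rwa [sub_right_comm]

theorem norm_sub_sub_sum_smul_le (hu : IsMeanFieldSolution q u)
    (hu_mem : ∀ t, 0 ≤ t → u t ∈ stdSimplex ℝ (Fin S)) (hK : IsRateBound q R K) (hR : 1 ≤ R)
    (hh : 0 ≤ h) (k : ℕ) :
    ‖u (k * h) - u 0 - ∑ j ∈ Finset.range k, h • (rateMatrix q (u (j * h)) *ᵥ u (j * h))‖ ≤
      k * (2 * K ^ 2 * h * h) := by
  have htelescope : u (k * h) - u 0 = ∑ j ∈ Finset.range k, (u (j * h + h) - u (j * h)) := by
    simpa [add_mul] using (Finset.sum_range_sub (fun j : ℕ => u (j * h)) k).symm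
  rw [htelescope, ← Finset.sum_sub_distrib]
  exact (norm_sum_le_of_le _ fun j _ =>
    hu.norm_sub_sub_smul_le hu_mem hK hR (by positivity) hh).trans_eq (by simp)

end IsMeanFieldSolution

theorem IsBalanced.norm_density_sub_le {N : ℕ} {p a : ℝ} {g : SimpleGraph (Fin N)}
    (hg : IsBalanced p g a) (hN : 2 ≤ N) (hp : 0 < p) (hp1 : p ≤ 1)
    (hK : IsRateBound q (2 / p) K) (hu : IsMeanFieldSolution q u)
    (hu_mem : ∀ t, 0 ≤ t → u t ∈ stdSimplex ℝ (Fin S)) (hh : 0 ≤ h) (ha : 2 * K ^ 2 * h ≤ a)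
    {m : ℕ} {c : ℕ → Config N S} (h0 : ‖density (c 0) - u 0‖ ≤ a)
    (hc : ∀ k ≤ m, ‖density (c k) - density (c 0) -
      ∑ j ∈ Finset.range k, h • meanDrift p q g (indicators (c j))‖ ≤ a + m * h * a)
    {k : ℕ} (hk : k ≤ m) :
    ‖density (c k) - u (k * h)‖ ≤
      (2 + 2 * (m * h) + m * h * (K * S)) * Real.exp (2 * K * (m * h)) * a := by
  have hK0 := hK.nonneg
  have ha0 : 0 ≤ a := (norm_nonneg _).trans h0
  have hR : 1 ≤ 2 / p := (one_le_div hp).2 (by linarith)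
  have hu_euler : ∀ k ≤ m, ‖u (k * h) - u ((0 : ℕ) * h) -
      ∑ j ∈ Finset.range k, h • (rateMatrix q (u (j * h)) *ᵥ u (j * h))‖ ≤ m * h * a := by
    intro k hk
    rw [Nat.cast_zero, zero_mul]
    calc _ ≤ (k : ℝ) * (2 * K ^ 2 * h * h) := hu.norm_sub_sub_sum_smul_le hu_mem hK hR hh k
      _ ≤ m * (a * h) := by gcongr
      _ = m * h * a := by ring
  have hdrift : ∀ j < m, ‖meanDrift p q g (indicators (c j)) -
      rateMatrix q (u (j * h)) *ᵥ u (j * h)‖ ≤ 2 * K * ‖density (c j) - u (j * h)‖ + K * S * a := by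
    intro j _
    have hmem := indicators_mem_stdSimplex (c j)
    have henv := hg.norm_meanDrift_sub_le hN hp hp1 hK hmem
    have hlip := hK.norm_drift_sub_le hR (average_mem_stdSimplex (by omega) hmem)
      (hu_mem (j * h) (by positivity))
    linarith [norm_sub_le_norm_sub_add_norm_sub (meanDrift p q g (indicators (c j)))
      (rateMatrix q (density (c j)) *ᵥ density (c j)) (rateMatrix q (u (j * h)) *ᵥ u (j * h))]
  calc ‖density (c k) - u (k * h)‖ ≤ (a + (a + m * h * a) + m * h * a + m * h * (K * S * a)) *
        Real.exp (2 * K * (m * h)) :=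
        norm_sub_le_mul_exp_of_approx_euler (x := fun k => density (c k))
          (u := fun k => u (k * h)) hh (by positivity) (by positivity) (by simpa using h0) hc
          hu_euler hdrift hk
    _ = _ := by ring

end MeanField

section Grid

variable {Ω : Type*} [mΩ : MeasurableSpace Ω] {N S : ℕ} {p : ℝ}
  {q : Fin S → Fin S → (Fin S → ℝ) → ℝ} {P : Measure Ω}
  {G : Ω → SimpleGraph (Fin N)} {σ : ℝ → Ω → Config N S} {h a v : ℝ}

namespace IsExactSystem

/-- The filtration generated by the graph and the process, along the grid of step `h`. -/
def gridFiltration (hσ : IsExactSystem p q P G σ) (hh : 0 ≤ h) : Filtration ℕ mΩ where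
  seq k := past G σ (k * h)
  mono' _ _ hij := past_mono (mul_le_mul_of_nonneg_right (Nat.cast_le.2 hij) hh)
  le' k := hσ.past_le (k * h)

theorem stronglyAdapted_density (hσ : IsExactSystem p q P G σ) (hh : 0 ≤ h) (l : Fin S) :
    StronglyAdapted (hσ.gridFiltration hh) fun k ω => density (σ (k * h) ω) l := fun _ =>
  ((Measurable.of_discrete (f := fun c : Config N S => density c l)).comp
    (measurable_process_past (G := G) ⟨by positivity, le_rfl⟩)).stronglyMeasurable

variable [IsFiniteMeasure P]

theorem measure_exists_le_abs_density_sub_predictablePart_le (hσ : IsExactSystem p q P G σ)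
    (hh : 0 ≤ h) (ha : 0 < a)
    (hsq : ∀ s, 0 ≤ s → ∀ l : Fin S,
      ∫ ω, (density (σ (s + h) ω) l - density (σ s ω) l) ^ 2 ∂P ≤ v * h) (m : ℕ) :
    P {ω | ∃ l, ∃ k ≤ m, a ≤ |density (σ (k * h) ω) l - density (σ 0 ω) l -
      predictablePart (fun k ω => density (σ (k * h) ω) l) (hσ.gridFiltration hh) P k ω|} ≤
      S * ENNReal.ofReal (m * h * v / a ^ 2) := by
  have hX2 (l : Fin S) (k : ℕ) : MemLp (fun ω => density (σ (k * h) ω) l) 2 P :=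
    (MemLp.of_discrete (f := fun c : Config N S => density c l)).comp_of_map
      (hσ.measurable_process (k * h) (by positivity)).aemeasurable
  have hmax (l : Fin S) := measure_exists_le_abs_sub_predictablePart_le
    (hσ.stronglyAdapted_density hh l) (hX2 l) ha m
  simp only [Nat.cast_zero, zero_mul] at hmax
  have hsum (l : Fin S) : ∑ j ∈ Finset.range m, ∫ ω,
      (density (σ ((j + 1 : ℕ) * h) ω) l - density (σ (j * h) ω) l) ^ 2 ∂P ≤ m * h * v := by
    refine (Finset.sum_le_sum fun j _ => ?_).trans_eq (b := ∑ _j ∈ Finset.range m, v * h) ?_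
    · rw [Nat.cast_succ, add_one_mul]
      exact hsq (j * h) (by positivity) l
    · simp only [Finset.sum_const, Finset.card_range, nsmul_eq_mul]
      ring
  rw [Set.ofPred_exists]
  refine (measure_iUnion_fintype_le _ _).trans ?_
  calc _ ≤ ∑ _l : Fin S, ENNReal.ofReal (m * h * v / a ^ 2) :=
        Finset.sum_le_sum fun l _ => (hmax l).trans
          (ENNReal.ofReal_le_ofReal (div_le_div_of_nonneg_right (hsum l) (sq_nonneg a)))
    _ = S * ENNReal.ofReal (m * h * v / a ^ 2) := by simp

theorem measure_exists_lt_norm_density_euler_le (hσ : IsExactSystem p q P G σ)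
    (hh : 0 ≤ h) (ha : 0 < a)
    (hdrift : ∀ s, 0 ≤ s → ∀ l : Fin S, ∀ᵐ ω ∂P,
      |(P[fun ω => density (σ (s + h) ω) l - density (σ s ω) l | past G σ s]) ω -
        h * meanDrift p q (G ω) (indicators (σ s ω)) l| ≤ a * h)
    (hsq : ∀ s, 0 ≤ s → ∀ l : Fin S,
      ∫ ω, (density (σ (s + h) ω) l - density (σ s ω) l) ^ 2 ∂P ≤ v * h) (m : ℕ) :
    P {ω | ∃ k ≤ m, a + m * h * a < ‖density (σ (k * h) ω) - density (σ 0 ω) -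
      ∑ j ∈ Finset.range k, h • meanDrift p q (G ω) (indicators (σ (j * h) ω))‖} ≤
      S * ENNReal.ofReal (m * h * v / a ^ 2) := by
  refine (measure_mono_ae ?_).trans
    (hσ.measure_exists_le_abs_density_sub_predictablePart_le hh ha hsq m)
  have hgrid : ∀ᵐ ω ∂P, ∀ (j : ℕ) (l : Fin S),
      |(P[(fun ω => density (σ ((j + 1 : ℕ) * h) ω) l) - fun ω => density (σ (j * h) ω) l |
          hσ.gridFiltration hh j]) ω -
        h * meanDrift p q (G ω) (indicators (σ (j * h) ω)) l| ≤ a * h := by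
    refine ae_all_iff.2 fun j => ae_all_iff.2 fun l => ?_
    rw [Nat.cast_succ, add_one_mul]
    exact hdrift (j * h) (by positivity) l
  filter_upwards [hgrid] with ω hω ⟨k, hk, hlarge⟩
  by_contra hgood
  refine hlarge.not_ge ((pi_norm_le_iff_of_nonneg (by positivity)).2 fun l => ?_)
  set A := predictablePart (fun k ω => density (σ (k * h) ω) l) (hσ.gridFiltration hh) P k ω
    with hA
  have hmart : |density (σ (k * h) ω) l - density (σ 0 ω) l - A| ≤ a :=
    le_of_not_ge fun hle => hgood ⟨l, k, hk, hle⟩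
  have hcompensator : |A - ∑ j ∈ Finset.range k,
      h * meanDrift p q (G ω) (indicators (σ (j * h) ω)) l| ≤ m * h * a := by
    rw [hA, predictablePart, Finset.sum_apply, ← Finset.sum_sub_distrib]
    calc _ ≤ ∑ _j ∈ Finset.range k, a * h :=
          (Finset.abs_sum_le_sum_abs _ _).trans (Finset.sum_le_sum fun j _ => hω j l)
      _ = k * h * a := by
          simp only [Finset.sum_const, Finset.card_range, nsmul_eq_mul]
          ring
      _ ≤ m * h * a := by gcongr
  simpa [Finset.sum_apply] using (abs_sub_le _ A _).trans (add_le_add hmart hcompensator)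

end IsExactSystem

end Grid

/-! ### Convergence of the exact system -/

section Dyadic

variable {t T : ℝ}

theorem tendsto_div_two_pow_nhdsGT_zero (hT : 0 < T) :
    Tendsto (fun n : ℕ => T / 2 ^ n) atTop (𝓝[>] 0) :=
  tendsto_nhdsWithin_iff.2
    ⟨tendsto_const_nhds.div_atTop (tendsto_pow_atTop_atTop_of_one_lt one_lt_two),
      .of_forall fun _ => Set.mem_Ioi.2 (by positivity)⟩

theorem exists_dyadic_tendsto_nhdsGT (ht : 0 ≤ t) (htT : t < T) :
    ∃ k : ℕ → ℕ, (∀ n, k n ≤ 2 ^ n) ∧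
      Tendsto (fun n => (k n : ℝ) * (T / 2 ^ n)) atTop (𝓝[>] t) := by
  have hT : 0 < T := ht.trans_lt htT
  have hgt (n : ℕ) : t < ((⌊t / (T / 2 ^ n)⌋₊ + 1 : ℕ) : ℝ) * (T / 2 ^ n) := by
    rw [← div_lt_iff₀ (by positivity), Nat.cast_succ]
    exact Nat.lt_floor_add_one _
  have hle (n : ℕ) : ((⌊t / (T / 2 ^ n)⌋₊ + 1 : ℕ) : ℝ) * (T / 2 ^ n) ≤ t + T / 2 ^ n := by
    rw [Nat.cast_succ, add_one_mul, add_le_add_iff_right, ← le_div_iff₀ (by positivity)]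
    exact Nat.floor_le (by positivity)
  refine ⟨fun n => ⌊t / (T / 2 ^ n)⌋₊ + 1, fun n => ?_,
    tendsto_nhdsWithin_iff.2 ⟨?_, .of_forall hgt⟩⟩
  · refine Nat.succ_le_of_lt ((Nat.floor_lt (by positivity)).2 ?_)
    rwa [div_lt_iff₀ (by positivity), Nat.cast_pow, Nat.cast_ofNat,
      mul_div_cancel₀ T (by positivity)]
  · have hlim : Tendsto (fun n : ℕ => t + T / 2 ^ n) atTop (𝓝 t) := by
      simpa using tendsto_const_nhds.add
        (tendsto_nhdsWithin_iff.1 (tendsto_div_two_pow_nhdsGT_zero hT)).1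
    exact tendsto_of_tendsto_of_tendsto_of_le_of_le tendsto_const_nhds hlim
      (fun n => (hgt n).le) hle

theorem exists_dyadic_lt_of_lt {f : ℝ → ℝ} {C : ℝ}
    (hf : ∀ t, 0 ≤ t → Tendsto f (𝓝[>] t) (𝓝 (f t))) (ht : t ∈ Set.Icc 0 T) (hC : C < f t) :
    ∃ n : ℕ, ∃ k : ℕ, k ≤ 2 ^ n ∧ C < f (k * (T / 2 ^ n)) := by
  obtain htT | rfl := ht.2.lt_or_eq
  · obtain ⟨k, hk, hlim⟩ := exists_dyadic_tendsto_nhdsGT ht.1 htT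
    obtain ⟨n, hn⟩ := (((hf t ht.1).comp hlim).eventually_const_lt hC).exists
    exact ⟨n, k n, hk n, hn⟩
  · exact ⟨0, 1, le_rfl, by simpa using hC⟩

theorem measure_exists_lt_le_of_eventually_dyadic {Ω : Type*} [MeasurableSpace Ω] {P : Measure Ω}
    {f : ℝ → Ω → ℝ} {C : ℝ} {b : ℝ≥0∞}
    (hf : ∀ᵐ ω ∂P, ∀ t, 0 ≤ t → Tendsto (fun r => f r ω) (𝓝[>] t) (𝓝 (f t ω)))
    (hb : ∀ᶠ n : ℕ in atTop, P {ω | ∃ k : ℕ, k ≤ 2 ^ n ∧ C < f (k * (T / 2 ^ n)) ω} ≤ b) :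
    P {ω | ∃ t ∈ Set.Icc 0 T, C < f t ω} ≤ b := by
  set E : ℕ → Set Ω := fun n => {ω | ∃ k : ℕ, k ≤ 2 ^ n ∧ C < f (k * (T / 2 ^ n)) ω}
  have hmono : Monotone E := by
    refine monotone_nat_of_le_succ fun n ω ⟨k, hk, hlt⟩ => ⟨2 * k, by rw [pow_succ]; omega, ?_⟩
    have hrefine : ((2 * k : ℕ) : ℝ) * (T / 2 ^ (n + 1)) = k * (T / 2 ^ n) := by
      push_cast
      field_simp
      ring
    rwa [hrefine]
  have hsub : P {ω | ∃ t ∈ Set.Icc 0 T, C < f t ω} ≤ P (⋃ n, E n) := by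
    refine measure_mono_ae ?_
    filter_upwards [hf] with ω hω ⟨t, ht, hlt⟩
    exact Set.mem_iUnion.2 (exists_dyadic_lt_of_lt hω ht hlt)
  exact hsub.trans (le_of_tendsto (tendsto_measure_iUnion_atTop hmono) hb)

end Dyadic

theorem IsMeanFieldSolution.continuousOn {S : ℕ} {q : Fin S → Fin S → (Fin S → ℝ) → ℝ}
    {u : ℝ → Fin S → ℝ} (hu : IsMeanFieldSolution q u) : ContinuousOn u (Set.Ici 0) :=
  fun t ht => (hu.2 t ht).continuousWithinAt

namespace IsExactSystem

variable {Ω : Type*} [MeasurableSpace Ω] {N S : ℕ} {p : ℝ}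
  {q : Fin S → Fin S → (Fin S → ℝ) → ℝ} {P : Measure Ω}
  {G : Ω → SimpleGraph (Fin N)} {σ : ℝ → Ω → Config N S} {u : ℝ → Fin S → ℝ}

theorem ae_tendsto_norm_density_sub (hσ : IsExactSystem p q P G σ)
    (hu : ContinuousOn u (Set.Ici 0)) :
    ∀ᵐ ω ∂P, ∀ t, 0 ≤ t → Tendsto (fun r => ‖density (σ r ω) - u r‖) (𝓝[>] t)
      (𝓝 ‖density (σ t ω) - u t‖) := by
  filter_upwards [hσ.right_continuous] with ω hω t ht
  have hut : Tendsto u (𝓝[>] t) (𝓝 (u t)) := (hu t ht).mono fun r hr => ht.trans (le_of_lt hr)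
  refine (tendsto_const_nhds.sub hut).norm.congr' ?_
  filter_upwards [hω t ht] with r hr
  rw [hr]

variable [IsFiniteMeasure P] {K a : ℝ}

theorem measure_exists_grid_lt_norm_density_sub_le {h v : ℝ} (hσ : IsExactSystem p q P G σ)
    (hN : 2 ≤ N) (hp : 0 < p) (hp1 : p ≤ 1) (hK : IsRateBound q (2 / p) K)
    (hu : IsMeanFieldSolution q u) (hu_mem : ∀ t, 0 ≤ t → u t ∈ stdSimplex ℝ (Fin S))
    (hh : 0 ≤ h) (ha : 0 < a) (hha : 2 * K ^ 2 * h ≤ a)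
    (hdrift : ∀ s, 0 ≤ s → ∀ l : Fin S, ∀ᵐ ω ∂P,
      |(P[fun ω => density (σ (s + h) ω) l - density (σ s ω) l | past G σ s]) ω -
        h * meanDrift p q (G ω) (indicators (σ s ω)) l| ≤ a * h)
    (hsq : ∀ s, 0 ≤ s → ∀ l : Fin S,
      ∫ ω, (density (σ (s + h) ω) l - density (σ s ω) l) ^ 2 ∂P ≤ v * h) (m : ℕ) :
    P {ω | ∃ k ≤ m, (2 + 2 * (m * h) + m * h * (K * S)) * Real.exp (2 * K * (m * h)) * a <
        ‖density (σ (k * h) ω) - u (k * h)‖} ≤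
      P {ω | ENNReal.ofReal a ≤ dist₁ (density (σ 0 ω)) (u 0)} +
      P {ω | ¬ IsBalanced p (G ω) a} + S * ENNReal.ofReal (m * h * v / a ^ 2) := by
  refine le_trans ?_ (add_le_add (measure_union_le _ _)
    (hσ.measure_exists_lt_norm_density_euler_le hh ha hdrift hsq m))
  refine (measure_mono ?_).trans (measure_union_le _ _)
  rintro ω ⟨k, hk, hlarge⟩
  by_contra hgood
  obtain ⟨hgraph, heuler⟩ := not_or.1 hgood
  obtain ⟨hinit, hbal⟩ := not_or.1 hgraph
  refine hlarge.not_ge ((not_not.1 hbal).norm_density_sub_le hN hp hp1 hK hu hu_mem hh hha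
    (c := fun k => σ (k * h) ω) ?_ (fun k hk => ?_) hk)
  · simpa using (norm_sub_lt_of_dist₁_lt (not_le.1 hinit)).le
  · simpa using not_lt.1 fun hlt => heuler ⟨k, hk, hlt⟩

end IsExactSystem

theorem IsExactSystem.measure_exists_lt_norm_density_sub_le {Ω : Type*} [MeasurableSpace Ω]
    {N S : ℕ} {p K a T : ℝ} {q : Fin S → Fin S → (Fin S → ℝ) → ℝ} {P : Measure Ω}
    [IsProbabilityMeasure P] {G : Ω → SimpleGraph (Fin N)} {σ : ℝ → Ω → Config N S}
    {u : ℝ → Fin S → ℝ} (hσ : IsExactSystem p q P G σ)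
    (hN : 2 ≤ N) (hp : 0 < p) (hp1 : p ≤ 1) (hK : IsRateBound q (2 / p) K)
    (hu : IsMeanFieldSolution q u) (hu_mem : ∀ t, 0 ≤ t → u t ∈ stdSimplex ℝ (Fin S))
    (ha : 0 < a) (hT : 0 < T) :
    P {ω | ∃ t ∈ Set.Icc 0 T, (2 + 2 * T + T * (K * S)) * Real.exp (2 * K * T) * a <
        ‖density (σ t ω) - u t‖} ≤
      P {ω | ENNReal.ofReal a ≤ dist₁ (density (σ 0 ω)) (u 0)} +
      P {ω | ¬ IsBalanced p (G ω) a} +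
      S * ENNReal.ofReal (T * (S * K + 1) / a ^ 2 / N) := by
  have hN0 : (0 : ℝ) < N := by exact_mod_cast (by omega : 0 < N)
  have hsmall : ∀ᶠ h : ℝ in 𝓝[>] 0, 2 * K ^ 2 * h ≤ a := by
    have hlim : Tendsto (fun h : ℝ => 2 * K ^ 2 * h) (𝓝 0) (𝓝 0) := by
      simpa using (continuous_const_mul (2 * K ^ 2)).tendsto (0 : ℝ)
    exact (hlim.mono_left nhdsWithin_le_nhds).eventually_le_const ha
  refine measure_exists_lt_le_of_eventually_dyadic
    (hσ.ae_tendsto_norm_density_sub hu.continuousOn) ?_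
  have hstep := tendsto_div_two_pow_nhdsGT_zero hT
  filter_upwards [hstep.eventually hsmall,
    hstep.eventually (hσ.eventually_abs_condExp_density_sub_le ha),
    hstep.eventually (hσ.eventually_integral_density_sub_sq_le hN hp hK (one_div_pos.2 hN0))]
    with n hn hdrift hsq
  have hgrid := hσ.measure_exists_grid_lt_norm_density_sub_le hN hp hp1 hK hu hu_mem
    (by positivity) ha hn hdrift hsq (2 ^ n)
  have hmesh : ((2 ^ n : ℕ) : ℝ) * (T / 2 ^ n) = T := by
    rw [Nat.cast_pow, Nat.cast_ofNat, mul_div_cancel₀ T (by positivity)]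
  have hvar : T * (S * K / N + 1 / N) / a ^ 2 = T * (S * K + 1) / a ^ 2 / N := by field_simp
  rwa [hmesh, hvar] at hgrid

theorem tendstoZeroInProbability_exact {S : ℕ} {q : Fin S → Fin S → (Fin S → ℝ) → ℝ}
    (hq_lip : ∀ k s, k ≠ s → LocallyLipschitz (q k s))
    (hq_nonneg : ∀ k s, k ≠ s → ∀ φ : Fin S → ℝ, (∀ l, 0 ≤ φ l) → 0 ≤ q k s φ)
    {p : unitInterval} (hp : 0 < p)
    {Ω : ℕ → Type*} [∀ N, MeasurableSpace (Ω N)] {P : ∀ N, Measure (Ω N)}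
    [∀ N, IsProbabilityMeasure (P N)] {G : ∀ N, Ω N → SimpleGraph (Fin N)}
    (hG : ∀ N, HasLaw (G N) (SimpleGraph.binomialRandom (Fin N) p) (P N))
    {σ : ∀ N, ℝ → Ω N → Config N S} (hσ : ∀ N, IsExactSystem p q (P N) (G N) (σ N))
    {u : ℝ → Fin S → ℝ} (hu : IsMeanFieldSolution q u)
    (h0 : TendstoZeroInProbability P fun N ω => dist₁ (density (σ N 0 ω)) (u 0))
    {T : ℝ} (hT : 0 < T) :
    TendstoZeroInProbability P fun N ω =>
      ⨆ t ∈ Set.Icc (0 : ℝ) T, dist₁ (density (σ N t ω)) (u t) := by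
  obtain ⟨K, hK⟩ := exists_isRateBound hq_lip (2 / p)
  refine tendstoZeroInProbability_iSup_dist₁ (x := fun N t ω => density (σ N t ω))
    (C := (2 + 2 * T + T * (K * S)) * Real.exp (2 * K * T)) fun a ha => ?_
  have hmart : Tendsto (fun N : ℕ =>
      (S : ℝ≥0∞) * ENNReal.ofReal (T * (S * K + 1) / a ^ 2 / N)) atTop (𝓝 0) := by
    simpa using ENNReal.Tendsto.const_mul (tendsto_ofReal_const_div_atTop _)
      (.inr (ENNReal.natCast_ne_top S))
  have hlim := ((h0 (ENNReal.ofReal a) (ENNReal.ofReal_pos.2 ha)).add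
    (tendsto_measure_not_isBalanced hp hG ha)).add hmart
  rw [add_zero, add_zero] at hlim
  refine tendsto_of_tendsto_of_tendsto_of_le_of_le' tendsto_const_nhds hlim
    (.of_forall fun _ => zero_le) ?_
  filter_upwards [eventually_ge_atTop 2] with N hN
  exact (hσ N).measure_exists_lt_norm_density_sub_le hN hp p.2.2 hK hu
    (fun t ht => hu.mem_stdSimplex hq_lip hq_nonneg ht) ha hT

end LocalDensity

theorem theorem1 {S : ℕ} (q : Fin S → Fin S → (Fin S → ℝ) → ℝ)
    (hq_lip : ∀ k s, k ≠ s → LocallyLipschitz (q k s))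
    (hq_nonneg : ∀ k s, k ≠ s → ∀ φ : Fin S → ℝ, (∀ l, 0 ≤ φ l) → 0 ≤ q k s φ)
    (p : unitInterval) (hp : 0 < p)
    {Ω : ℕ → Type*} [∀ N, MeasurableSpace (Ω N)]
    (P : ∀ N, Measure (Ω N)) [∀ N, IsProbabilityMeasure (P N)]
    (G : ∀ N, Ω N → SimpleGraph (Fin N))
    (hG : ∀ N, HasLaw (G N) (SimpleGraph.binomialRandom (Fin N) p) (P N))
    (σ : ∀ N, ℝ → Ω N → LocalDensity.Config N S)
    (hσ : ∀ N, LocalDensity.IsExactSystem p q (P N) (G N) (σ N))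
    (z : ∀ N, Ω N → ℝ → Fin N → Fin S → ℝ)
    (hz : ∀ N, ∀ᵐ ω ∂(P N), LocalDensity.IsNIMFASolution p q (G N ω) (z N ω))
    (u : ℝ → Fin S → ℝ) (hu : LocalDensity.IsMeanFieldSolution q u) :
    (LocalDensity.TendstoZeroInProbability P (fun N ω =>
        LocalDensity.dist₁ (LocalDensity.average (LocalDensity.indicators (σ N 0 ω))) (u 0)) →
      ∀ T : ℝ, 0 < T → LocalDensity.TendstoZeroInProbability P (fun N ω =>
        ⨆ t ∈ Set.Icc (0 : ℝ) T,
          LocalDensity.dist₁ (LocalDensity.average (LocalDensity.indicators (σ N t ω))) (u t))) ∧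
    (LocalDensity.TendstoZeroInProbability P (fun N ω =>
        LocalDensity.dist₁ (LocalDensity.average (z N ω 0)) (u 0)) →
      ∀ T : ℝ, 0 < T → LocalDensity.TendstoZeroInProbability P (fun N ω =>
        ⨆ t ∈ Set.Icc (0 : ℝ) T,
          LocalDensity.dist₁ (LocalDensity.average (z N ω t)) (u t))) :=
  ⟨fun h0 _ hT =>
      LocalDensity.tendstoZeroInProbability_exact hq_lip hq_nonneg hp hG hσ hu h0 hT,
    fun h0 T _ => LocalDensity.tendstoZeroInProbability_nimfa hq_lip hq_nonneg hp hG hz hu h0 T⟩
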